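/- Let $\Gamma=(X,R)$ be a finite connected simple graph with path-length distance $\partial$ and diameter $D$. Assume that $\Gamma$ is distance-regular, i.e. for all $0\le h,i,j\le D$ and all $x,y\in X$ with $\partial(x,y)=h$ the number $p^h_{ij}=|\{z\in X:\partial(x,z)=i,\ \partial(z,y)=j\}|$ does not depend on the choice of $x,y$. Put $c_i=p^i_{1,i-1}$ $(1\le i\le D)$, $b_i=p^i_{1,i+1}$ $(0\le i\le D-1)$, $k=b_0$ (the valency) and $d=\lfloor D/2\rfloor$. Let $\theta_0>\theta_1>\cdots>\theta_D$ be the distinct eigenvalues of the adjacency matrix $A$ of $\Gamma$. Put $$\Delta=(k-2)(c_3-1)-(c_2-1)p^2_{22},\qquad \tilde\theta_n=-1-\frac{b_2b_3}{\theta_n^2-b_2}\quad(n\in\{1,d\}).$$ The graph $\Gamma$ is called taut if $\Delta\neq0$ and $$b_3\bigl(b_2(k-2)-(c_2-1)\theta_1^2\bigr)\bigl(b_2(k-2)-(c_2-1)\theta_d^2\bigr)=b_1\Delta(\theta_1^2-b_2)(b_2-\theta_d^2).$$ For $x\in X$ let $E_i^*=E_i^*(x)$ $(0\le i\le D)$ be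 the diagonal matrix in $\mathrm{Mat}_X(\mathbb C)$ whose $(y,y)$ entry is $1$ if $\partial(x,y)=i$ and $0$ otherwise, and let $T(x)$ be the subalgebra of $\mathrm{Mat}_X(\mathbb C)$ generated by $A,E_0^*,\dots,E_D^*$. A $T(x)$-module is a subspace $W\subseteq\mathbb C^X$ with $BW\subseteq W$ for all $B\in T(x)$; it is irreducible if $W\ne0$ and the only $T(x)$-modules contained in $W$ are $0$ and $W$. The endpoint of an irreducible $T(x)$-module $W$ is $\min\{i: 0\le i\le D,\ E_i^*W\ne0\}$, and $W$ is thin if $\dim E_i^*W\le1$ for $0\le i\le D$. If $W$ is thin and irreducible with endpoint $2$, its local eigenvalue is the eigenvalue of $E_2^*A_2E_2^*$ on the one-dimensional space $E_2^*W$, where $A_2$ is the matrix with $(y,z)$ entry $1$ if $\partial(y,z)=2$ and $0$ otherwise. We say that $\Gamma$ is taut with respect to $x$ if every irreducible $T(x)$-module with endpoint $2$ is thin with local eigenvalue $\tilde\theta_1$ or $\tilde\theta_d$. **Theorem.** Let $\Gamma$ be a bipartite distance-regular graph with diameter $D\ge4$ and valency $k\ge3$, and assume that $D$ is odd. Then the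 following are equivalent: (i) $\Gamma$ is taut; (ii) $\Delta\ne0$ and $\Gamma$ is taut with respect to every vertex; (iii) $\Delta\ne0$ and $\Gamma$ is taut with respect to at least one vertex. -/

import Mathlib

open scoped Matrix

namespace SimpleGraph

variable {X : Type*} [Fintype X]

/-! ### Distance-regular graphs and their intersection numbers -/

/-- The number of vertices `z` with `∂(x,z) = i` and `∂(z,y) = j`. -/
noncomputable def distCount (G : SimpleGraph X) (x y : X) (i j : ℕ) : ℕ :=
  (Finset.univ.filter fun z => G.dist x z = i ∧ G.dist z y = j).card

/-- A connected finite graph is distance-regular if for all `h, i, j ≤ D` and all vertices `x, y`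
with `∂(x,y) = h`, the number of `z` with `∂(x,z) = i`, `∂(z,y) = j` is independent of `x, y`. -/
def IsDistanceRegular (G : SimpleGraph X) : Prop :=
  G.Connected ∧
    ∀ h i j : ℕ, h ≤ G.diam → i ≤ G.diam → j ≤ G.diam →
      ∀ x y x' y' : X, G.dist x y = h → G.dist x' y' = h →
        G.distCount x y i j = G.distCount x' y' i j

/-- The intersection number `p^h_{ij}`: the maximum over all pairs `x, y` at distance `h` of the
number of `z` with `∂(x,z) = i`, `∂(z,y) = j`. In a distance-regular graph this number is the same
for all such pairs, see `IsDistanceRegular.distCount_eq`. -/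
noncomputable def interNum (G : SimpleGraph X) (h i j : ℕ) : ℕ :=
  (Finset.univ.filter fun q : X × X => G.dist q.1 q.2 = h).sup fun q => G.distCount q.1 q.2 i j

theorem IsDistanceRegular.distCount_eq {G : SimpleGraph X} (hG : G.IsDistanceRegular)
    {i j : ℕ} (hi : i ≤ G.diam) (hj : j ≤ G.diam) (x y : X) :
    G.distCount x y i j = G.interNum (G.dist x y) i j := by
  have hfin : G.ediam ≠ ⊤ := by
    have := hG.1.nonempty
    exact connected_iff_ediam_ne_top.mp hG.1
  apply le_antisymm
  · exact Finset.le_sup (f := fun q : X × X => G.distCount q.1 q.2 i j)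
      (b := (x, y)) (by simp)
  · refine Finset.sup_le fun q hq => ?_
    exact (hG.2 _ i j (dist_le_diam hfin) hi hj q.1 q.2 x y (by simpa using hq) rfl).le

/-- `c_i = p^i_{1,i-1}` (and `c_0 = 0`). -/
noncomputable def drgC (G : SimpleGraph X) (i : ℕ) : ℕ := G.interNum i 1 (i - 1)

/-- `b_i = p^i_{1,i+1}`. -/
noncomputable def drgB (G : SimpleGraph X) (i : ℕ) : ℕ := G.interNum i 1 (i + 1)

/-- The valency `k = b_0`. -/
noncomputable def valency (G : SimpleGraph X) : ℕ := G.drgB 0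

variable [DecidableEq X]

/-- The list of distinct eigenvalues of the adjacency matrix, in decreasing order. -/
noncomputable def eigenvalueList (G : SimpleGraph X) [DecidableRel G.Adj] : List ℝ :=
  (Matrix.finite_real_spectrum (A := G.adjMatrix ℝ)).toFinset.sort (· ≥ ·)

/-- The eigenvalue `θ_i`, where `θ_0 > θ_1 > ⋯` are the distinct eigenvalues of the adjacency
matrix. (A distance-regular graph of diameter `D` has exactly `D + 1` of them; the default
value `0` is only used beyond the end of the list.) -/
noncomputable def theta (G : SimpleGraph X) [DecidableRel G.Adj] (i : ℕ) : ℝ :=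
  G.eigenvalueList.getD i 0

/-! ### The taut condition -/

/-- `Δ = (k - 2)(c_3 - 1) - (c_2 - 1) p^2_{22}`. -/
noncomputable def tautDelta (G : SimpleGraph X) : ℝ :=
  ((G.valency : ℝ) - 2) * ((G.drgC 3 : ℝ) - 1) - ((G.drgC 2 : ℝ) - 1) * (G.interNum 2 2 2 : ℝ)

/-- `Γ` is taut if `Δ ≠ 0` and, with `d = ⌊D/2⌋`,
`b_3 (b_2(k-2) - (c_2-1)θ_1²)(b_2(k-2) - (c_2-1)θ_d²) = b_1 Δ (θ_1² - b_2)(b_2 - θ_d²)`. -/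
def IsTaut (G : SimpleGraph X) [DecidableRel G.Adj] : Prop :=
  G.tautDelta ≠ 0 ∧
    (G.drgB 3 : ℝ) *
        ((G.drgB 2 : ℝ) * ((G.valency : ℝ) - 2) - ((G.drgC 2 : ℝ) - 1) * G.theta 1 ^ 2) *
        ((G.drgB 2 : ℝ) * ((G.valency : ℝ) - 2)
          - ((G.drgC 2 : ℝ) - 1) * G.theta (G.diam / 2) ^ 2) =
      (G.drgB 1 : ℝ) * G.tautDelta *
        (G.theta 1 ^ 2 - (G.drgB 2 : ℝ)) * ((G.drgB 2 : ℝ) - G.theta (G.diam / 2) ^ 2)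

/-- `z̃ = -1 - b_2 b_3 / (z² - b_2)`, for real `z` with `z² ≠ b_2`. -/
noncomputable def tildeVal (G : SimpleGraph X) (z : ℝ) : ℝ :=
  -1 - (G.drgB 2 : ℝ) * (G.drgB 3 : ℝ) / (z ^ 2 - (G.drgB 2 : ℝ))

/-! ### The subconstituent algebra and its modules -/

/-- The `i`-th distance matrix `A_i`. -/
noncomputable def distMatrix (G : SimpleGraph X) (i : ℕ) : Matrix X X ℂ :=
  Matrix.of fun y z => if G.dist y z = i then 1 else 0

/-- The `i`-th dual idempotent `E_i^*(x)`. -/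
noncomputable def dualIdem (G : SimpleGraph X) (x : X) (i : ℕ) : Matrix X X ℂ :=
  Matrix.diagonal fun y => if G.dist x y = i then 1 else 0

/-- The subconstituent (Terwilliger) algebra `T(x)`, generated by `A` and
`E_0^*(x), …, E_D^*(x)`. -/
noncomputable def subconstAlg (G : SimpleGraph X) [DecidableRel G.Adj] (x : X) :
    Subalgebra ℂ (Matrix X X ℂ) :=
  Algebra.adjoin ℂ ({G.adjMatrix ℂ} ∪ {B | ∃ i ≤ G.diam, B = G.dualIdem x i})

/-- A `T(x)`-module: a subspace of `ℂ^X` closed under the action of `T(x)`. -/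
def IsTModule (G : SimpleGraph X) [DecidableRel G.Adj] (x : X) (W : Submodule ℂ (X → ℂ)) : Prop :=
  ∀ B ∈ G.subconstAlg x, ∀ w ∈ W, B *ᵥ w ∈ W

/-- An irreducible `T(x)`-module. -/
def IsIrredTModule (G : SimpleGraph X) [DecidableRel G.Adj] (x : X)
    (W : Submodule ℂ (X → ℂ)) : Prop :=
  G.IsTModule x W ∧ W ≠ ⊥ ∧ ∀ W' : Submodule ℂ (X → ℂ), G.IsTModule x W' → W' ≤ W →
    W' = ⊥ ∨ W' = W

/-- The subspace `E_i^*(x) W`. -/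
noncomputable def dualPart (G : SimpleGraph X) (x : X) (i : ℕ) (W : Submodule ℂ (X → ℂ)) :
    Submodule ℂ (X → ℂ) :=
  W.map (G.dualIdem x i).mulVecLin

/-- `W` is thin (with respect to `x`): `dim E_i^* W ≤ 1` for `0 ≤ i ≤ D`. -/
def IsThin (G : SimpleGraph X) (x : X) (W : Submodule ℂ (X → ℂ)) : Prop :=
  ∀ i ≤ G.diam, Module.finrank ℂ (G.dualPart x i W) ≤ 1

/-- The endpoint of `W` (with respect to `x`): `min {i | 0 ≤ i ≤ D, E_i^* W ≠ 0}`. -/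
noncomputable def endpoint (G : SimpleGraph X) (x : X) (W : Submodule ℂ (X → ℂ)) : ℕ :=
  sInf {i : ℕ | i ≤ G.diam ∧ G.dualPart x i W ≠ ⊥}

/-- `η` is the local eigenvalue of `W`, for `W` a thin irreducible `T(x)`-module with endpoint 2:
the eigenvalue of `E_2^* A_2 E_2^*` on the one-dimensional space `E_2^* W`. -/
def HasLocalEigenvalue (G : SimpleGraph X) (x : X) (W : Submodule ℂ (X → ℂ)) (η : ℝ) : Prop :=
  ∀ v ∈ G.dualPart x 2 W,
    (G.dualIdem x 2 * G.distMatrix 2 * G.dualIdem x 2) *ᵥ v = (η : ℂ) • v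

/-- `Γ` is taut with respect to `x`: every irreducible `T(x)`-module with endpoint 2 is thin with
local eigenvalue `θ̃_1` or `θ̃_d`, where `d = ⌊D/2⌋`. -/
def IsTautAt (G : SimpleGraph X) [DecidableRel G.Adj] (x : X) : Prop :=
  ∀ W : Submodule ℂ (X → ℂ), G.IsIrredTModule x W → G.endpoint x W = 2 →
    G.IsThin x W ∧
      (G.HasLocalEigenvalue x W (G.tildeVal (G.theta 1)) ∨
        G.HasLocalEigenvalue x W (G.tildeVal (G.theta (G.diam / 2))))

end SimpleGraph

/-!
Let `B = E_2^* A_2 E_2^*` and let `P` be the orthogonal projection onto the vectors supported on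
the sphere of radius two and orthogonal to the range of `E_2^* A E_1^*`; these are the candidates
for `E_2^* W` with `W` of endpoint two. For `θ ∈ {θ_1, θ_d}` let `K` be a positive multiple of the
primitive idempotent of `θ`. Because the entries of `K` depend on the distance only, `P K P` is a
nonzero multiple of `(B - θ̃) P`. So `(B - θ̃_1) P` and `(B - θ̃_d) P` are commuting matrices,
each semidefinite up to sign, and their product vanishes if and only if its trace does. This trace
is a polynomial in the intersection numbers, and up to a nonzero factor it is the difference of the
two sides of the taut condition.

If the product vanishes, then `E_2^* W` contains an eigenvector `v` of `B` for `θ̃_1` or `θ̃_d`.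
For the corresponding `K` this gives `⟨v, K v⟩ = 0`, hence `K v = 0`. Restricted to a sphere around
`x`, this and the equation `J v = 0` for the all-ones matrix `J` are two linear relations between at
most three vectors of the form `A_j v`. They are independent because `θ` is extremal, so all of
these are multiples of one, which makes `W` thin. Conversely, the product vanishes on every
irreducible module if `Γ` is taut with respect to `x`.
-/

section Distance

variable {V : Type*} {G : SimpleGraph V}

theorem exists_dist_eq_and_add_dist_eq (hG : G.Connected) {y z : V} {j : ℕ}
    (hj : j ≤ G.dist y z) : ∃ w, G.dist y w = j ∧ j + G.dist w z = G.dist y z := by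
  obtain ⟨p, hp⟩ := hG.exists_walk_length_eq_dist y z
  refine ⟨p.getVert j, ?_⟩
  have htake := G.dist_le (p.take j)
  have hdrop := G.dist_le (p.drop j)
  have htri := hG.dist_triangle (u := y) (v := p.getVert j) (w := z)
  simp only [SimpleGraph.Walk.take_length, SimpleGraph.Walk.drop_length] at htake hdrop
  omega

theorem exists_dist_eq_of_le_diam (hG : G.Connected) {i : ℕ} (hi : i ≤ G.diam) :
    ∃ y z, G.dist y z = i := by
  have := hG.nonempty
  obtain ⟨u, v, huv⟩ := G.exists_dist_eq_diam
  obtain ⟨w, hw, -⟩ := exists_dist_eq_and_add_dist_eq hG (huv ▸ hi)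
  exact ⟨u, w, hw⟩

theorem dist_le_diam_of_connected [Finite V] (hG : G.Connected) (x y : V) :
    G.dist x y ≤ G.diam := by
  have := hG.nonempty
  exact SimpleGraph.dist_le_diam (SimpleGraph.connected_iff_ediam_ne_top.mp hG)

theorem even_dist_iff (hG : G.Connected) (c : G.Coloring Bool) (x y : V) :
    Even (G.dist x y) ↔ (c x ↔ c y) := by
  obtain ⟨p, hp⟩ := hG.exists_walk_length_eq_dist x y
  rw [← hp, c.even_length_iff_congr p]

theorem dist_add_dist_add_dist_mod_two (hG : G.Connected) (hb : G.IsBipartite) (x y z : V) :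
    (G.dist x y + G.dist y z + G.dist x z) % 2 = 0 := by
  obtain ⟨c⟩ := hb
  rw [← Nat.even_iff, Nat.even_add, Nat.even_add]
  simp only [even_dist_iff hG (G.recolorOfEquiv finTwoEquiv c)]
  tauto

end Distance

section DistanceRegular

variable {V : Type*} [Fintype V] {G : SimpleGraph V}

theorem distCount_eq_zero {x y : V} {i j : ℕ} (h : ∀ z, G.dist x z = i → G.dist z y ≠ j) :
    G.distCount x y i j = 0 := by
  rw [SimpleGraph.distCount, Finset.card_eq_zero, Finset.filter_eq_empty_iff]
  exact fun z _ hz => h z hz.1 hz.2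

theorem interNum_eq_zero {h i j : ℕ}
    (H : ∀ x y z : V, G.dist x y = h → G.dist x z = i → G.dist z y ≠ j) :
    G.interNum h i j = 0 := by
  rw [SimpleGraph.interNum, ← Nat.bot_eq_zero, Finset.sup_eq_bot_iff]
  rintro ⟨x, y⟩ hxy
  exact distCount_eq_zero fun z => H x y z (by simpa using hxy)

theorem drgB_eq_zero (hG : G.Connected) {i : ℕ} (hi : G.diam ≤ i) : G.drgB i = 0 :=
  interNum_eq_zero fun _ y z _ _ hzy => by
    have := dist_le_diam_of_connected hG z y
    omega

theorem drgC_zero (hG : G.Connected) : G.drgC 0 = 0 :=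
  interNum_eq_zero fun x y z hxy hxz hzy => by
    have := hG.dist_triangle (u := x) (v := y) (w := z)
    rw [SimpleGraph.dist_comm] at hzy
    omega

variable (hG : G.IsDistanceRegular)
include hG

theorem distCount_eq_interNum (i j : ℕ) (x y : V) :
    G.distCount x y i j = G.interNum (G.dist x y) i j := by
  have hle := dist_le_diam_of_connected hG.1
  by_cases hij : i ≤ G.diam ∧ j ≤ G.diam
  · exact hG.distCount_eq hij.1 hij.2 x y
  · have hne (x y z : V) : G.dist x z = i → G.dist z y ≠ j := by
      have := hle x z
      have := hle z y
      omega
    rw [distCount_eq_zero (hne x y), interNum_eq_zero fun x y z _ => hne x y z]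

theorem interNum_pos {x y z : V} : 0 < G.interNum (G.dist x y) (G.dist x z) (G.dist z y) := by
  rw [← distCount_eq_interNum hG, SimpleGraph.distCount, Finset.card_pos]
  exact ⟨z, by simp⟩

theorem drgC_pos {i : ℕ} (h1 : 1 ≤ i) (hi : i ≤ G.diam) : 0 < G.drgC i := by
  obtain ⟨y, z, rfl⟩ := exists_dist_eq_of_le_diam hG.1 hi
  obtain ⟨w, hw, hwz⟩ := exists_dist_eq_and_add_dist_eq hG.1 h1
  have := interNum_pos hG (x := y) (y := z) (z := w)
  rwa [hw, show G.dist w z = G.dist y z - 1 by omega] at this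

theorem drgB_pos {i : ℕ} (hi : i < G.diam) : 0 < G.drgB i := by
  obtain ⟨y, z, hyz⟩ := exists_dist_eq_of_le_diam hG.1 (i := i + 1) hi
  obtain ⟨w, hw, hwz⟩ := exists_dist_eq_and_add_dist_eq hG.1 (y := y) (z := z) (j := 1) (by omega)
  have := interNum_pos hG (x := w) (y := z) (z := y)
  rwa [hyz, G.dist_comm (v := y), hw, show G.dist w z = i by omega] at this

theorem drgC_one (h1 : 1 ≤ G.diam) : G.drgC 1 = 1 := by
  obtain ⟨y, z, hyz⟩ := exists_dist_eq_of_le_diam hG.1 h1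
  have hcount := distCount_eq_interNum hG 1 0 y z
  rw [hyz] at hcount
  rw [SimpleGraph.drgC, ← hcount, SimpleGraph.distCount, Finset.card_eq_one]
  refine ⟨z, Finset.ext fun w => ?_⟩
  simp only [Finset.mem_filter_univ, hG.1.dist_eq_zero_iff, Finset.mem_singleton,
    and_iff_right_iff_imp]
  rintro rfl
  exact hyz

end DistanceRegular

/-- A bipartite distance-regular graph. -/
structure IsBipartiteDRG {V : Type*} [Fintype V] (G : SimpleGraph V) : Prop where
  drg : G.IsDistanceRegular
  bip : G.IsBipartite

namespace IsBipartiteDRG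

section IntersectionNumbers

variable {V : Type*} [Fintype V] {G : SimpleGraph V} (hG : IsBipartiteDRG G)
include hG

theorem conn : G.Connected := hG.drg.1

theorem dist_le (x y : V) : G.dist x y ≤ G.diam := dist_le_diam_of_connected hG.conn x y

theorem even_dist (x y z : V) : (G.dist x y + G.dist y z + G.dist x z) % 2 = 0 :=
  dist_add_dist_add_dist_mod_two hG.conn hG.bip x y z

theorem dist_tri (x y z : V) : G.dist x z ≤ G.dist x y + G.dist y z := hG.conn.dist_triangle

theorem sum_dist_eq_one {M : Type*} [AddCommMonoid M] (e : ℕ → M) (y z : V) :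
    ∑ w with G.dist y w = 1, e (G.dist w z) =
      G.drgC (G.dist y z) • e (G.dist y z - 1) + G.drgB (G.dist y z) • e (G.dist y z + 1) := by
  simp only [SimpleGraph.drgC, SimpleGraph.drgB, ← distCount_eq_interNum hG.drg,
    SimpleGraph.distCount, ← Finset.sum_const, Finset.sum_filter, ← Finset.sum_add_distrib]
  refine Finset.sum_congr rfl fun w _ => ?_
  by_cases hyw : G.dist y w = 1
  · have htri := hG.dist_tri y w z
    have htri' := hG.dist_tri w y z
    have heven := hG.even_dist y w z
    rw [G.dist_comm (u := w) (v := y)] at htri'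
    obtain h | h : G.dist w z = G.dist y z - 1 ∧ G.dist w z ≠ G.dist y z + 1 ∨
        G.dist w z = G.dist y z + 1 ∧ G.dist w z ≠ G.dist y z - 1 := by omega
    · rw [if_pos hyw, if_pos ⟨hyw, h.1⟩, if_neg fun h' => h.2 h'.2, h.1, add_zero]
    · rw [if_pos hyw, if_neg fun h' => h.2 h'.2, if_pos ⟨hyw, h.1⟩, h.1, zero_add]
  · simp [hyw]

theorem card_dist_eq_one (y : V) : Finset.card {w | G.dist y w = 1} = G.valency := by
  have h := hG.sum_dist_eq_one (fun _ => 1) y y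
  simpa [drgC_zero hG.conn, SimpleGraph.valency] using h

theorem drgC_add_drgB {i : ℕ} (hi : i ≤ G.diam) : G.drgC i + G.drgB i = G.valency := by
  obtain ⟨y, z, rfl⟩ := exists_dist_eq_of_le_diam hG.conn hi
  have h := hG.sum_dist_eq_one (fun _ => 1) y z
  rw [Finset.sum_const, hG.card_dist_eq_one] at h
  simpa using h.symm

end IntersectionNumbers

end IsBipartiteDRG

section HermitianPolynomial

open Polynomial
open scoped MatrixOrder

variable {V : Type*} [Fintype V] [DecidableEq V] {A : Matrix V V ℝ} {g : ℝ[X]}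

theorem mem_spectrum_iff_exists_mulVec_eq {μ : ℝ} :
    μ ∈ spectrum ℝ A ↔ ∃ u : V → ℝ, u ≠ 0 ∧ A *ᵥ u = μ • u := by
  simp only [← Matrix.spectrum_toLin', ← Module.End.hasEigenvalue_iff_mem_spectrum,
    Module.End.hasEigenvalue_iff, Submodule.ne_bot_iff, Module.End.mem_eigenspace_iff,
    Matrix.toLin'_apply, and_comm]

theorem aeval_eq_zero_iff_forall_eval_eq_zero (hA : A.IsHermitian) :
    aeval A g = 0 ↔ ∀ μ ∈ spectrum ℝ A, g.eval μ = 0 := by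
  have hA' : IsSelfAdjoint A := hA
  rw [← cfc_polynomial g A hA', ← cfc_zero ℝ A, cfc_eq_cfc_iff_eqOn]
  rfl

theorem posSemidef_aeval (hA : A.IsHermitian) (hg : ∀ μ ∈ spectrum ℝ A, 0 ≤ g.eval μ) :
    (aeval A g).PosSemidef := by
  have hA' : IsSelfAdjoint A := hA
  rw [← Matrix.nonneg_iff_posSemidef, ← cfc_polynomial g A hA']
  exact cfc_nonneg hg

theorem isHermitian_aeval (hA : A.IsHermitian) : (aeval A g).IsHermitian := by
  have hA' : IsSelfAdjoint A := hA
  rw [← cfc_polynomial g A hA']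
  exact cfc_predicate (R := ℝ) g.eval A

theorem exists_aeval_ne_zero_and_mul_eq_smul (hA : A.IsHermitian) {θ : ℝ}
    (hθ : θ ∈ spectrum ℝ A) : ∃ g : ℝ[X], aeval A g ≠ 0 ∧ A * aeval A g = θ • aeval A g := by
  set S := (Matrix.finite_real_spectrum (A := A)).toFinset
  have hmem (μ : ℝ) : μ ∈ S ↔ μ ∈ spectrum ℝ A := Set.Finite.mem_toFinset _
  refine ⟨∏ μ ∈ S.erase θ, (X - C μ), fun h => ?_, ?_⟩
  · have hroot := (aeval_eq_zero_iff_forall_eval_eq_zero hA).1 h θ hθ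
    rw [eval_prod, Finset.prod_eq_zero_iff] at hroot
    obtain ⟨μ, hμ, hμθ⟩ := hroot
    exact Finset.ne_of_mem_erase hμ (by simpa [sub_eq_zero, eq_comm] using hμθ)
  · have hkill : aeval A ((X - C θ) * ∏ μ ∈ S.erase θ, (X - C μ)) = 0 := by
      refine (aeval_eq_zero_iff_forall_eval_eq_zero hA).2 fun μ hμ => ?_
      rw [Finset.mul_prod_erase S (fun μ => X - C μ) ((hmem θ).2 hθ), eval_prod]
      exact Finset.prod_eq_zero ((hmem μ).2 hμ) (by simp)
    rwa [map_mul, map_sub, aeval_X, aeval_C, sub_mul, ← Algebra.smul_def, sub_eq_zero] at hkill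

end HermitianPolynomial

section PosSemidef

open scoped MatrixOrder ComplexOrder

variable {𝕜 V : Type*} [RCLike 𝕜] [Fintype V]

theorem mul_eq_zero_of_trace_mul_eq_zero {M N : Matrix V V 𝕜} (hM : M.PosSemidef)
    (hN : N.PosSemidef) (h : (M * N).trace = 0) : M * N = 0 := by
  classical
  set P := CFC.sqrt M
  set Q := CFC.sqrt N
  have hP : Pᴴ = P := (CFC.sqrt_nonneg M).isSelfAdjoint
  have hQ : Qᴴ = Q := (CFC.sqrt_nonneg N).isSelfAdjoint
  have hPP : P * P = M := CFC.sqrt_mul_sqrt_self M hM.nonneg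
  have hQQ : Q * Q = N := CFC.sqrt_mul_sqrt_self N hN.nonneg
  have hPQ : P * Q = 0 := by
    rw [← Matrix.trace_conjTranspose_mul_self_eq_zero_iff, Matrix.conjTranspose_mul, hP, hQ,
      Matrix.mul_assoc, Matrix.trace_mul_comm, Matrix.mul_assoc, Matrix.mul_assoc, hQQ,
      ← Matrix.mul_assoc, hPP, h]
  rw [← hPP, ← hQQ, Matrix.mul_assoc, ← Matrix.mul_assoc P Q, hPQ, Matrix.zero_mul,
    Matrix.mul_zero]

end PosSemidef

section AdjMatrix

open Polynomial

variable {V : Type*} {G : SimpleGraph V} [DecidableRel G.Adj]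

theorem isHermitian_adjMatrix {R : Type*} [NonAssocSemiring R] [StarRing R] :
    (G.adjMatrix R).IsHermitian := by
  ext y z
  simp [SimpleGraph.adjMatrix_apply, G.adj_comm z y, apply_ite star]

variable [Fintype V] [DecidableEq V]

theorem adjMatrix_pow_apply_eq_zero {n : ℕ} {y z : V} (h : n < G.dist y z) :
    (G.adjMatrix ℝ ^ n) y z = 0 := by
  rw [SimpleGraph.adjMatrix_pow_apply_eq_card_walk, Nat.cast_eq_zero, Fintype.card_eq_zero_iff]
  exact ⟨fun p => (G.dist_le p.1).not_gt (lt_of_eq_of_lt p.2 h)⟩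

theorem adjMatrix_pow_dist_apply_ne_zero (hG : G.Connected) (y z : V) :
    (G.adjMatrix ℝ ^ G.dist y z) y z ≠ 0 := by
  rw [SimpleGraph.adjMatrix_pow_apply_eq_card_walk, Nat.cast_ne_zero, ← Nat.pos_iff_ne_zero,
    Fintype.card_pos_iff]
  obtain ⟨p, hp⟩ := hG.exists_walk_length_eq_dist y z
  exact ⟨⟨p, hp⟩⟩

theorem aeval_adjMatrix_apply_eq_zero {g : ℝ[X]} {y z : V} (h : g.natDegree < G.dist y z) :
    (aeval (G.adjMatrix ℝ) g) y z = 0 := by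
  rw [aeval_eq_sum_range, Matrix.sum_apply]
  refine Finset.sum_eq_zero fun n hn => ?_
  rw [Matrix.smul_apply, adjMatrix_pow_apply_eq_zero (by grind), smul_zero]

theorem diam_lt_natDegree_of_aeval_eq_zero (hG : G.Connected) {g : ℝ[X]} (hg : g ≠ 0)
    (h : aeval (G.adjMatrix ℝ) g = 0) : G.diam < g.natDegree := by
  by_contra! hle
  obtain ⟨y, z, hyz⟩ := exists_dist_eq_of_le_diam hG hle
  have hcoeff : g.leadingCoeff * (G.adjMatrix ℝ ^ G.dist y z) y z = 0 := by
    have h' := congrFun (congrFun h y) z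
    rwa [aeval_eq_sum_range, Matrix.sum_apply, Finset.sum_range_succ, Finset.sum_eq_zero,
      zero_add, Matrix.smul_apply, coeff_natDegree, ← hyz] at h'
    intro n hn
    rw [Matrix.smul_apply, adjMatrix_pow_apply_eq_zero (by grind), smul_zero]
  exact mul_ne_zero (leadingCoeff_ne_zero.2 hg) (adjMatrix_pow_dist_apply_ne_zero hG y z) hcoeff

theorem diam_lt_card_spectrum (hG : G.Connected) :
    G.diam < (Matrix.finite_real_spectrum (A := G.adjMatrix ℝ)).toFinset.card := by
  set S := (Matrix.finite_real_spectrum (A := G.adjMatrix ℝ)).toFinset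
  have hmonic : (∏ μ ∈ S, (X - C μ)).Monic := monic_prod_X_sub_C _ _
  have h := diam_lt_natDegree_of_aeval_eq_zero hG hmonic.ne_zero
    ((aeval_eq_zero_iff_forall_eval_eq_zero isHermitian_adjMatrix).2 fun μ hμ => by
      rw [eval_prod]
      exact Finset.prod_eq_zero ((Set.Finite.mem_toFinset _).2 hμ) (by simp))
  simpa [natDegree_prod_of_monic _ _ fun μ (_ : μ ∈ S) => monic_X_sub_C μ] using h

theorem neg_mem_spectrum_adjMatrix (hb : G.IsBipartite) {μ : ℝ}
    (hμ : μ ∈ spectrum ℝ (G.adjMatrix ℝ)) : -μ ∈ spectrum ℝ (G.adjMatrix ℝ) := by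
  obtain ⟨c⟩ := hb
  obtain ⟨u, hu, hAu⟩ := mem_spectrum_iff_exists_mulVec_eq.1 hμ
  -- Changing the sign of an eigenvector on one colour class negates the eigenvalue.
  let s : V → ℝ := fun y => if c y = 0 then 1 else -1
  have hs_sq (y : V) : s y * s y = 1 := by simp only [s]; split_ifs <;> norm_num
  have hs_adj {y z : V} (h : G.Adj y z) : s z = -s y := by
    have hne := c.valid h
    simp only [s]
    split_ifs with hz hy
    · exact absurd (hy.trans hz.symm) hne
    all_goals grind
  refine mem_spectrum_iff_exists_mulVec_eq.2 ⟨fun y => s y * u y, fun h => hu ?_, ?_⟩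
  · ext y
    have hy : s y * (s y * u y) = 0 := by rw [show s y * u y = 0 from congrFun h y, mul_zero]
    rwa [← mul_assoc, hs_sq, one_mul] at hy
  · ext y
    have hy := congrFun hAu y
    simp only [SimpleGraph.adjMatrix_mulVec_apply, Pi.smul_apply, smul_eq_mul] at hy ⊢
    calc ∑ z ∈ G.neighborFinset y, s z * u z = ∑ z ∈ G.neighborFinset y, -s y * u z :=
          Finset.sum_congr rfl fun z hz => by rw [hs_adj (by simpa using hz)]
      _ = -μ * (s y * u y) := by rw [← Finset.mul_sum, hy]; ring

theorem natCast_mem_spectrum_adjMatrix [Nonempty V] {k : ℕ} (hk : G.IsRegularOfDegree k) :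
    (k : ℝ) ∈ spectrum ℝ (G.adjMatrix ℝ) := by
  refine mem_spectrum_iff_exists_mulVec_eq.2 ⟨Function.const V 1, one_ne_zero, ?_⟩
  ext y
  simp [hk y]

theorem abs_le_of_mem_spectrum_adjMatrix {k : ℕ} (hk : G.IsRegularOfDegree k) {μ : ℝ}
    (hμ : μ ∈ spectrum ℝ (G.adjMatrix ℝ)) : |μ| ≤ k := by
  rw [← Matrix.spectrum_toLin', ← Module.End.hasEigenvalue_iff_mem_spectrum] at hμ
  obtain ⟨y, hy⟩ := eigenvalue_mem_ball hμ
  rw [SimpleGraph.adjMatrix_apply, if_neg (G.irrefl), mem_closedBall_zero_iff,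
    Real.norm_eq_abs] at hy
  calc |μ| ≤ ∑ z ∈ Finset.univ.erase y, ‖G.adjMatrix ℝ y z‖ := hy
    _ = ∑ z, G.adjMatrix ℝ y z := by
      rw [← Finset.add_sum_erase _ _ (Finset.mem_univ y)]
      simp [SimpleGraph.adjMatrix_apply, apply_ite abs]
    _ = k := by
      simp [SimpleGraph.adjMatrix_apply, ← SimpleGraph.card_neighborFinset_eq_degree,
        SimpleGraph.neighborFinset_eq_filter, ← hk y]

end AdjMatrix

section DistKernel

variable {V R : Type*} [CommRing R]

/-- The matrix whose entries depend on the distance only, through the sequence `e`. For a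
distance-regular graph these matrices form the Bose-Mesner algebra, with basis the distance
matrices `distKernel G (Pi.single i 1)`; the values of `e` beyond the diameter are irrelevant. -/
noncomputable def distKernel (G : SimpleGraph V) : (ℕ → R) →ₗ[R] Matrix V V R where
  toFun e := Matrix.of fun y z => e (G.dist y z)
  map_add' _ _ := rfl
  map_smul' _ _ := rfl

variable {G : SimpleGraph V}

theorem distKernel_apply (e : ℕ → R) (y z : V) : distKernel G e y z = e (G.dist y z) := rfl

theorem distKernel_transpose (e : ℕ → R) : (distKernel G e)ᵀ = distKernel G e := by
  ext y z
  rw [Matrix.transpose_apply, distKernel_apply, distKernel_apply, G.dist_comm]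

theorem distKernel_single_one [DecidableRel G.Adj] :
    distKernel G (Pi.single 1 1) = G.adjMatrix R := by
  ext y z
  simp [distKernel_apply, Pi.single_apply, SimpleGraph.dist_eq_one_iff_adj]

theorem distKernel_single_zero [Fintype V] [DecidableEq V] (hG : G.Connected) (a : R) :
    distKernel G (Pi.single 0 a) = algebraMap R (Matrix V V R) a := by
  ext y z
  simp [distKernel_apply, Pi.single_apply, hG.dist_eq_zero_iff, Matrix.algebraMap_matrix_apply]

theorem trace_distKernel [Fintype V] (e : ℕ → R) :
    (distKernel G e).trace = Fintype.card V * e 0 := by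
  simp [Matrix.trace, distKernel_apply]

/-- The sequence representing `A * distKernel G e`, see
`IsBipartiteDRG.adjMatrix_mul_distKernel`. -/
noncomputable def adjShift [Fintype V] (G : SimpleGraph V) (e : ℕ → R) (h : ℕ) : R :=
  G.drgC h * e (h - 1) + G.drgB h * e (h + 1)

end DistKernel

namespace IsBipartiteDRG

section BoseMesner

variable {V R : Type*} [Fintype V] [CommRing R] {G : SimpleGraph V} (hG : IsBipartiteDRG G)
include hG

theorem distKernel_congr {e f : ℕ → R} (h : ∀ i ≤ G.diam, e i = f i) :
    distKernel G e = distKernel G f := by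
  ext y z
  exact h _ (hG.dist_le y z)

theorem distKernel_single_eq_zero {i : ℕ} (hi : G.diam < i) (a : R) :
    distKernel G (Pi.single i a) = 0 := by
  rw [← map_zero (distKernel G)]
  exact hG.distKernel_congr fun j hj => by simp [show j ≠ i by omega]

theorem valency_smul_distKernel_single (j : ℕ) (a : R) :
    (G.valency : R) • distKernel G (Pi.single j a) =
      (G.drgC j : R) • distKernel G (Pi.single j a) +
        (G.drgB j : R) • distKernel G (Pi.single j a) := by
  rcases le_or_gt j G.diam with hj | hj
  · rw [← add_smul, ← Nat.cast_add, hG.drgC_add_drgB hj]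
  · simp [hG.distKernel_single_eq_zero hj]

variable [DecidableRel G.Adj]

theorem adjMatrix_mul_distKernel (e : ℕ → R) :
    G.adjMatrix R * distKernel G e = distKernel G (adjShift G e) := by
  ext y z
  have h := hG.sum_dist_eq_one e y z
  rw [nsmul_eq_mul, nsmul_eq_mul] at h
  simp [← distKernel_single_one, Matrix.mul_apply, distKernel_apply, Pi.single_apply, adjShift,
    ← h, Finset.sum_filter]

theorem distKernel_mul_adjMatrix (e : ℕ → R) :
    distKernel G e * G.adjMatrix R = distKernel G (adjShift G e) := by
  have h := congrArg Matrix.transpose (hG.adjMatrix_mul_distKernel e)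
  rwa [Matrix.transpose_mul, G.transpose_adjMatrix, distKernel_transpose,
    distKernel_transpose] at h

theorem adjMatrix_mul_distKernel_single (j : ℕ) :
    G.adjMatrix R * distKernel G (Pi.single (j + 1) 1) =
      (G.drgB j : R) • distKernel G (Pi.single j 1) +
        (G.drgC (j + 2) : R) • distKernel G (Pi.single (j + 2) 1) := by
  rw [hG.adjMatrix_mul_distKernel, ← map_smul, ← map_smul, ← map_add]
  refine congrArg _ (funext fun h => ?_)
  simp only [adjShift, Pi.single_apply, Pi.add_apply, Pi.smul_apply, smul_eq_mul]
  rcases eq_or_ne h j with rfl | h1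
  · simp [show h - 1 ≠ h + 1 by omega]
  rcases eq_or_ne h (j + 2) with rfl | h2
  · simp
  · simp [h1, h2, show h - 1 ≠ j + 1 by omega]

open Polynomial in
theorem exists_aeval_adjMatrix_eq_distKernel [DecidableEq V] (g : R[X]) :
    ∃ e, aeval (G.adjMatrix R) g = distKernel G e := by
  induction g using Polynomial.induction_on with
  | C a => exact ⟨_, by rw [aeval_C, distKernel_single_zero hG.conn]⟩
  | add p q hp hq =>
    obtain ⟨⟨e, he⟩, f, hf⟩ := And.intro hp hq
    exact ⟨e + f, by rw [map_add, map_add, he, hf]⟩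
  | monomial n a ih =>
    obtain ⟨e, he⟩ := ih
    exact ⟨adjShift G e, by
      rw [pow_succ, ← mul_assoc, map_mul, aeval_X, he, hG.distKernel_mul_adjMatrix]⟩

end BoseMesner

end IsBipartiteDRG

section DistSum

variable {V : Type*} {G : SimpleGraph V}

/-- The coefficients of the sum `A_i + A_{i-2} + A_{i-4} + ⋯` of distance matrices. -/
def distSumCoeff (R : Type*) [CommRing R] (i : ℕ) : ℕ → R :=
  fun h => if h ≤ i ∧ Even (i + h) then 1 else 0

theorem distSumCoeff_add_two (R : Type*) [CommRing R] (i : ℕ) :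
    distSumCoeff R (i + 2) = distSumCoeff R i + Pi.single (i + 2) 1 := by
  funext h
  simp only [distSumCoeff, Pi.add_apply, Pi.single_apply]
  grind

end DistSum

namespace IsBipartiteDRG

section DistSum

variable {V R : Type*} [Fintype V] [CommRing R] {G : SimpleGraph V} [DecidableRel G.Adj]
  (hG : IsBipartiteDRG G)
include hG

theorem adjMatrix_mul_distKernel_distSumCoeff (i : ℕ) :
    G.adjMatrix R * distKernel G (distSumCoeff R i) =
      (G.valency : R) • distKernel G (distSumCoeff R (i + 1)) -
        (G.drgB (i + 1) : R) • distKernel G (Pi.single (i + 1) 1) := by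
  rw [hG.adjMatrix_mul_distKernel, ← map_smul, ← map_smul, ← map_sub]
  refine hG.distKernel_congr fun h hh => ?_
  have hk : (G.valency : R) = G.drgC h + G.drgB h := by
    rw [← hG.drgC_add_drgB hh, Nat.cast_add]
  have hC : h = 0 → (G.drgC h : R) = 0 := by
    rintro rfl
    rw [drgC_zero hG.conn, Nat.cast_zero]
  simp only [adjShift, distSumCoeff, Pi.sub_apply, Pi.smul_apply, smul_eq_mul, Pi.single_apply, hk]
  rcases lt_trichotomy h (i + 1) with hlt | rfl | hgt
  · grind
  · grind
  · grind

theorem adjMatrix_mul_distKernel_distSumCoeff_succ {i : ℕ} (hi : i + 2 ≤ G.diam) :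
    G.adjMatrix R * distKernel G (distSumCoeff R (i + 1)) =
      (G.drgC (i + 2) : R) • distKernel G (distSumCoeff R (i + 2)) +
        (G.drgB (i + 2) : R) • distKernel G (distSumCoeff R i) := by
  rw [hG.adjMatrix_mul_distKernel_distSumCoeff, distSumCoeff_add_two, map_add,
    ← hG.drgC_add_drgB hi, Nat.cast_add]
  module

/-- A form of the Christoffel-Darboux identity. -/
theorem valency_sq_smul_sub_adjMatrix_mul_adjMatrix_mul {i : ℕ} (hi : i + 1 ≤ G.diam) :
    (G.valency : R) ^ 2 • distKernel G (distSumCoeff R i) -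
        G.adjMatrix R * (G.adjMatrix R * distKernel G (distSumCoeff R i)) =
      ((G.drgB i : R) * G.drgB (i + 1)) • distKernel G (Pi.single i 1) -
        ((G.drgC (i + 1) : R) * G.drgC (i + 2)) • distKernel G (Pi.single (i + 2) 1) := by
  have hk : (G.valency : R) = G.drgC (i + 1) + G.drgB (i + 1) := by
    rw [← hG.drgC_add_drgB hi, Nat.cast_add]
  have hsingle := hG.valency_smul_distKernel_single (i + 2) (1 : R)
  rw [hG.adjMatrix_mul_distKernel_distSumCoeff, Matrix.mul_sub, Matrix.mul_smul, Matrix.mul_smul,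
    hG.adjMatrix_mul_distKernel_distSumCoeff, hG.adjMatrix_mul_distKernel_single,
    distSumCoeff_add_two, map_add, smul_add (G.valency : R), hsingle, hk]
  module

end DistSum

end IsBipartiteDRG

section DistSumPoly

open Polynomial

/-- The polynomial `p_i` of degree `i` with `p_i(A) = A_i + A_{i-2} + A_{i-4} + ⋯` for `i ≤ D`. -/
noncomputable def distSumPoly {V : Type*} [Fintype V] (G : SimpleGraph V) : ℕ → ℝ[X]
  | 0 => 1
  | 1 => X
  | i + 2 => C (G.drgC (i + 2) : ℝ)⁻¹ *
      (X * distSumPoly G (i + 1) - C (G.drgB (i + 2) : ℝ) * distSumPoly G i)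

variable {V : Type*} [Fintype V] {G : SimpleGraph V}

theorem natDegree_distSumPoly_le (i : ℕ) : (distSumPoly G i).natDegree ≤ i := by
  induction i using Nat.twoStepInduction with
  | zero => simp [distSumPoly]
  | one => simp [distSumPoly]
  | more i ih ih' =>
    refine (natDegree_C_mul_le _ _).trans ((natDegree_sub_le _ _).trans (max_le ?_ ?_))
    · exact natDegree_mul_le.trans (by rw [natDegree_X]; omega)
    · exact (natDegree_C_mul_le _ _).trans (ih.trans (by omega))

theorem eval_neg_distSumPoly (i : ℕ) (t : ℝ) :
    (distSumPoly G i).eval (-t) = (-1) ^ i * (distSumPoly G i).eval t := by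
  induction i using Nat.twoStepInduction with
  | zero => simp [distSumPoly]
  | one => simp [distSumPoly]
  | more i ih ih' =>
    simp only [distSumPoly, eval_mul, eval_sub, eval_C, eval_X, ih, ih']
    ring

namespace IsBipartiteDRG

variable (hG : IsBipartiteDRG G)
include hG

theorem drgC_mul_eval_distSumPoly {i : ℕ} (hi : i + 2 ≤ G.diam) (t : ℝ) :
    (G.drgC (i + 2) : ℝ) * (distSumPoly G (i + 2)).eval t =
      t * (distSumPoly G (i + 1)).eval t - G.drgB (i + 2) * (distSumPoly G i).eval t := by
  have hc : (G.drgC (i + 2) : ℝ) ≠ 0 := by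
    exact_mod_cast (drgC_pos hG.drg (by omega) hi).ne'
  simp only [distSumPoly, eval_mul, eval_C, eval_sub, eval_X]
  field_simp

variable [DecidableEq V] [DecidableRel G.Adj]

theorem aeval_distSumPoly {i : ℕ} (hi : i ≤ G.diam) :
    aeval (G.adjMatrix ℝ) (distSumPoly G i) = distKernel G (distSumCoeff ℝ i) := by
  induction i using Nat.twoStepInduction with
  | zero =>
    rw [distSumPoly, map_one, ← map_one (algebraMap ℝ (Matrix V V ℝ)),
      ← distKernel_single_zero hG.conn]
    refine congrArg _ (funext fun h => ?_)
    simp only [distSumCoeff, Pi.single_apply]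
    grind
  | one =>
    rw [distSumPoly, aeval_X, ← distKernel_single_one]
    refine congrArg _ (funext fun h => ?_)
    simp only [distSumCoeff, Pi.single_apply]
    grind
  | more i ih ih' =>
    have hc : (G.drgC (i + 2) : ℝ) ≠ 0 := by
      exact_mod_cast (drgC_pos hG.drg (by omega) hi).ne'
    rw [distSumPoly, map_mul, map_sub, map_mul, map_mul, aeval_X, aeval_C, aeval_C,
      ih (by omega), ih' (by omega), hG.adjMatrix_mul_distKernel_distSumCoeff_succ hi,
      ← Algebra.smul_def, ← Algebra.smul_def, add_sub_cancel_right, inv_smul_smul₀ hc]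

theorem aeval_valency_sq_sub_mul_distSumPoly {i : ℕ} (hi : i + 1 ≤ G.diam) :
    aeval (G.adjMatrix ℝ) ((C ((G.valency : ℝ) ^ 2) - X ^ 2) * distSumPoly G i) =
      distKernel G (Pi.single i ((G.drgB i : ℝ) * G.drgB (i + 1)) -
        Pi.single (i + 2) ((G.drgC (i + 1) : ℝ) * G.drgC (i + 2))) := by
  rw [map_mul, map_sub, aeval_C, aeval_X_pow, hG.aeval_distSumPoly (by omega), sub_mul,
    ← Algebra.smul_def, sq (G.adjMatrix ℝ), mul_assoc,
    hG.valency_sq_smul_sub_adjMatrix_mul_adjMatrix_mul hi, ← map_smul, ← map_smul, ← map_sub,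
    ← Pi.single_smul', ← Pi.single_smul', smul_eq_mul, smul_eq_mul, mul_one, mul_one]

end IsBipartiteDRG

end DistSumPoly

/-- A nonzero eigenvalue `θ ≠ ±k` whose square is the largest or the smallest among the squares of
the eigenvalues other than `±k`, according to the sign of `ε`. -/
structure IsExtremalEigenvalue {V : Type*} [Fintype V] [DecidableEq V] (G : SimpleGraph V)
    [DecidableRel G.Adj] (θ : ℝ) : Prop where
  mem : θ ∈ spectrum ℝ (G.adjMatrix ℝ)
  ne_zero : θ ≠ 0
  sq_ne : θ ^ 2 ≠ (G.valency : ℝ) ^ 2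
  exists_sign : ∃ ε : ℝ, ε ≠ 0 ∧ ∀ μ ∈ spectrum ℝ (G.adjMatrix ℝ), μ ^ 2 ≠ (G.valency : ℝ) ^ 2 →
    0 ≤ ε * (μ ^ 2 - θ ^ 2)

namespace IsBipartiteDRG

section Extremal

open Polynomial

variable {V : Type*} [Fintype V] {G : SimpleGraph V} (hG : IsBipartiteDRG G)
include hG

theorem drgC_two_mul_eval_distSumPoly_two (hD : 2 ≤ G.diam) (t : ℝ) :
    (G.drgC 2 : ℝ) * (distSumPoly G 2).eval t = t ^ 2 - G.drgB 2 := by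
  rw [hG.drgC_mul_eval_distSumPoly hD]
  simp only [distSumPoly, eval_X, eval_one]
  ring

theorem distSumPoly_ne_zero {i : ℕ} (hi : i ≤ G.diam) : distSumPoly G i ≠ 0 := by
  classical
  intro h
  obtain ⟨y, z, rfl⟩ := exists_dist_eq_of_le_diam hG.conn hi
  have hentry := congrFun (congrFun (hG.aeval_distSumPoly hi) y) z
  simp [h, distKernel_apply, distSumCoeff] at hentry

theorem exists_distSumPoly_eq_mul {θ : ℝ} (hθ : θ ≠ 0) {i : ℕ} (hi : i ≤ G.diam)
    (hroot : (distSumPoly G i).eval θ = 0) :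
    ∃ q : ℝ[X], q.natDegree < i ∧ distSumPoly G i = (X ^ 2 - C (θ ^ 2)) * q := by
  have hroot' : (distSumPoly G i).eval (-θ) = 0 := by rw [eval_neg_distSumPoly, hroot, mul_zero]
  have hcop : IsCoprime (X - C θ) (X - C (-θ)) :=
    isCoprime_X_sub_C_of_isUnit_sub (isUnit_iff_ne_zero.2 (by simpa using hθ))
  obtain ⟨q, hq⟩ := hcop.mul_dvd (dvd_iff_isRoot.2 hroot) (dvd_iff_isRoot.2 hroot')
  rw [show (X - C θ) * (X - C (-θ)) = X ^ 2 - C (θ ^ 2) by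
    rw [C_neg, C_pow]; ring] at hq
  refine ⟨q, ?_, hq⟩
  have hpne := hG.distSumPoly_ne_zero hi
  have hdeg := natDegree_distSumPoly_le (G := G) i
  rw [hq] at hpne hdeg
  rw [natDegree_mul (left_ne_zero_of_mul hpne) (right_ne_zero_of_mul hpne),
    natDegree_X_pow_sub_C] at hdeg
  omega

variable [DecidableRel G.Adj]

theorem isRegularOfDegree : G.IsRegularOfDegree G.valency := fun y => by
  rw [← hG.card_dist_eq_one y, ← SimpleGraph.card_neighborFinset_eq_degree,
    SimpleGraph.neighborFinset_eq_filter]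
  simp only [SimpleGraph.dist_eq_one_iff_adj]

variable [DecidableEq V]

theorem sq_le_valency_sq {μ : ℝ} (hμ : μ ∈ spectrum ℝ (G.adjMatrix ℝ)) :
    μ ^ 2 ≤ (G.valency : ℝ) ^ 2 :=
  sq_le_sq' (abs_le.1 (abs_le_of_mem_spectrum_adjMatrix hG.isRegularOfDegree hμ)).1
    (abs_le.1 (abs_le_of_mem_spectrum_adjMatrix hG.isRegularOfDegree hμ)).2

theorem aeval_valency_sq_sub_mul_distSumPoly_ne_zero {i : ℕ} (hi : i + 2 ≤ G.diam) :
    aeval (G.adjMatrix ℝ) ((C ((G.valency : ℝ) ^ 2) - X ^ 2) * distSumPoly G i) ≠ 0 := by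
  intro h
  obtain ⟨y, z, rfl⟩ := exists_dist_eq_of_le_diam hG.conn (show i ≤ G.diam by omega)
  have hentry := congrFun (congrFun
    (h.symm.trans (hG.aeval_valency_sq_sub_mul_distSumPoly (by omega))) y) z
  have hb := drgB_pos hG.drg (show G.dist y z < G.diam by omega)
  have hb' := drgB_pos hG.drg (show G.dist y z + 1 < G.diam by omega)
  simp [distKernel_apply, hb.ne', hb'.ne'] at hentry

theorem valency_sq_sub_mul_eval_eq_zero_of_trace_eq_zero {g : ℝ[X]}
    (hg : ∀ μ ∈ spectrum ℝ (G.adjMatrix ℝ), μ ^ 2 ≠ (G.valency : ℝ) ^ 2 → 0 ≤ g.eval μ)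
    (htrace : (aeval (G.adjMatrix ℝ) ((C ((G.valency : ℝ) ^ 2) - X ^ 2) * g)).trace = 0)
    {μ : ℝ} (hμ : μ ∈ spectrum ℝ (G.adjMatrix ℝ)) :
    ((G.valency : ℝ) ^ 2 - μ ^ 2) * g.eval μ = 0 := by
  have hpos : (aeval (G.adjMatrix ℝ) ((C ((G.valency : ℝ) ^ 2) - X ^ 2) * g)).PosSemidef := by
    refine posSemidef_aeval isHermitian_adjMatrix fun μ hμ => ?_
    simp only [eval_mul, eval_sub, eval_C, eval_pow, eval_X]
    rcases eq_or_ne (μ ^ 2) ((G.valency : ℝ) ^ 2) with h | h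
    · rw [h, sub_self, zero_mul]
    · exact mul_nonneg (sub_nonneg.2 (hG.sq_le_valency_sq hμ)) (hg μ hμ h)
  simpa using (aeval_eq_zero_iff_forall_eval_eq_zero isHermitian_adjMatrix).1
    (hpos.trace_eq_zero_iff.1 htrace) μ hμ

omit hG in
theorem trace_distKernel_mul_aeval_eq_zero {e : ℕ → ℝ} {i : ℕ} (he : ∀ h < i, e h = 0)
    {g : ℝ[X]} (hg : g.natDegree < i) :
    (distKernel G e * aeval (G.adjMatrix ℝ) g).trace = 0 := by
  simp only [Matrix.trace, Matrix.diag_apply, Matrix.mul_apply, distKernel_apply]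
  refine Finset.sum_eq_zero fun y _ => Finset.sum_eq_zero fun z _ => ?_
  rcases lt_or_ge (G.dist y z) i with h | h
  · rw [he _ h, zero_mul]
  · rw [aeval_adjMatrix_apply_eq_zero (hg.trans_le (G.dist_comm ▸ h)), mul_zero]

/-- If `p_i(θ) = 0` then `p_i = (X² - θ²) q`, and `(k² - A²) p_i(A) q(A)` is semidefinite because
`θ` is extremal; but its trace vanishes because `deg q < i`. -/
theorem eval_distSumPoly_ne_zero {θ : ℝ} (hθ : IsExtremalEigenvalue G θ) {i : ℕ}
    (hi : i + 2 ≤ G.diam) : (distSumPoly G i).eval θ ≠ 0 := by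
  intro hroot
  obtain ⟨q, hdeg, hq⟩ := hG.exists_distSumPoly_eq_mul hθ.ne_zero (by omega) hroot
  obtain ⟨ε, hε, hsign⟩ := hθ.exists_sign
  have htrace : (aeval (G.adjMatrix ℝ) ((C ((G.valency : ℝ) ^ 2) - X ^ 2) *
      (C ε * (distSumPoly G i * q)))).trace = 0 := by
    rw [show (C ((G.valency : ℝ) ^ 2) - X ^ 2) * (C ε * (distSumPoly G i * q)) =
      (C ((G.valency : ℝ) ^ 2) - X ^ 2) * distSumPoly G i * (C ε * q) by ring, map_mul,
      hG.aeval_valency_sq_sub_mul_distSumPoly (by omega)]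
    refine trace_distKernel_mul_aeval_eq_zero (fun h hh => ?_)
      ((natDegree_C_mul_le _ _).trans_lt hdeg)
    simp [hh.ne, show h ≠ i + 2 by omega]
  refine hG.aeval_valency_sq_sub_mul_distSumPoly_ne_zero hi
    ((aeval_eq_zero_iff_forall_eval_eq_zero isHermitian_adjMatrix).2 fun μ hμ => ?_)
  have hzero := hG.valency_sq_sub_mul_eval_eq_zero_of_trace_eq_zero (fun μ hμ hne => ?_) htrace hμ
  · simp only [hq, eval_mul, eval_sub, eval_C, eval_pow, eval_X] at hzero ⊢
    grind
  · simp only [hq, eval_mul, eval_sub, eval_C, eval_pow, eval_X]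
    nlinarith [mul_nonneg (hsign μ hμ hne) (sq_nonneg (q.eval μ))]

theorem sq_ne_drgB_two {θ : ℝ} (hθ : IsExtremalEigenvalue G θ) (hD : 4 ≤ G.diam) :
    θ ^ 2 - G.drgB 2 ≠ 0 := by
  rw [← hG.drgC_two_mul_eval_distSumPoly_two (by omega)]
  have hc := drgC_pos hG.drg (show 1 ≤ 2 by omega) (by omega)
  exact mul_ne_zero (by exact_mod_cast hc.ne') (hG.eval_distSumPoly_ne_zero hθ (by omega))

end Extremal

end IsBipartiteDRG

section Theta

open Polynomial

variable {V : Type*} [Fintype V] [DecidableEq V] {G : SimpleGraph V} [DecidableRel G.Adj]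

theorem mem_eigenvalueList {μ : ℝ} :
    μ ∈ G.eigenvalueList ↔ μ ∈ spectrum ℝ (G.adjMatrix ℝ) := by
  simp [SimpleGraph.eigenvalueList]

theorem sortedGT_eigenvalueList : G.eigenvalueList.SortedGT := Finset.sortedGT_sort _

theorem reverse_map_neg_eigenvalueList (hb : G.IsBipartite) :
    (G.eigenvalueList.map fun t => -t).reverse = G.eigenvalueList := by
  refine List.SortedGT.eq_of_mem_iff ?_ sortedGT_eigenvalueList fun μ => ?_
  · rw [List.sortedGT_iff_pairwise, List.pairwise_reverse, List.pairwise_map]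
    exact sortedGT_eigenvalueList.pairwise.imp fun h => neg_lt_neg h
  · simp only [List.mem_reverse, List.mem_map, mem_eigenvalueList]
    constructor
    · rintro ⟨t, ht, rfl⟩
      exact neg_mem_spectrum_adjMatrix hb ht
    · exact fun h => ⟨-μ, neg_mem_spectrum_adjMatrix hb h, neg_neg μ⟩

namespace IsBipartiteDRG

variable (hG : IsBipartiteDRG G)
include hG

theorem card_spectrum_le (h1 : 1 ≤ G.diam) :
    (Matrix.finite_real_spectrum (A := G.adjMatrix ℝ)).toFinset.card ≤ G.diam + 1 := by
  set g : ℝ[X] := (X ^ 2 - C ((G.valency : ℝ) ^ 2)) * distSumPoly G (G.diam - 1) with hg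
  have hzero : aeval (G.adjMatrix ℝ) g = 0 := by
    rw [hg, ← neg_sub, neg_mul, map_neg,
      hG.aeval_valency_sq_sub_mul_distSumPoly (by omega), map_sub,
      hG.distKernel_single_eq_zero (i := G.diam - 1 + 2) (by omega),
      drgB_eq_zero hG.conn (i := G.diam - 1 + 1) (by omega)]
    simp
  have hg0 : g ≠ 0 := mul_ne_zero (X_pow_sub_C_ne_zero two_pos _)
    (hG.distSumPoly_ne_zero (Nat.sub_le _ _))
  have hsub : (Matrix.finite_real_spectrum (A := G.adjMatrix ℝ)).toFinset ⊆ g.roots.toFinset :=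
    fun μ hμ => Multiset.mem_toFinset.2 ((mem_roots hg0).2
      ((aeval_eq_zero_iff_forall_eval_eq_zero isHermitian_adjMatrix).1 hzero μ
        ((Set.Finite.mem_toFinset _).1 hμ)))
  calc _ ≤ g.roots.toFinset.card := Finset.card_le_card hsub
    _ ≤ g.roots.card := Multiset.toFinset_card_le _
    _ ≤ g.natDegree := card_roots' g
    _ ≤ 2 + (G.diam - 1) := natDegree_mul_le.trans
      (add_le_add natDegree_X_pow_sub_C.le (natDegree_distSumPoly_le _))
    _ = G.diam + 1 := by omega

theorem length_eigenvalueList (h1 : 1 ≤ G.diam) : G.eigenvalueList.length = G.diam + 1 := by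
  rw [SimpleGraph.eigenvalueList, Finset.length_sort]
  exact (hG.card_spectrum_le h1).antisymm (diam_lt_card_spectrum hG.conn)

theorem theta_eq_getElem (h1 : 1 ≤ G.diam) {i : ℕ} (hi : i ≤ G.diam) :
    G.theta i = G.eigenvalueList[i]'(by rw [hG.length_eigenvalueList h1]; omega) :=
  List.getD_eq_getElem _ _ _

theorem theta_mem_spectrum (h1 : 1 ≤ G.diam) {i : ℕ} (hi : i ≤ G.diam) :
    G.theta i ∈ spectrum ℝ (G.adjMatrix ℝ) := by
  rw [hG.theta_eq_getElem h1 hi, ← mem_eigenvalueList]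
  exact List.getElem_mem _

theorem exists_theta_eq (h1 : 1 ≤ G.diam) {μ : ℝ} (h : μ ∈ spectrum ℝ (G.adjMatrix ℝ)) :
    ∃ i ≤ G.diam, G.theta i = μ := by
  obtain ⟨i, hi, rfl⟩ := List.getElem_of_mem (mem_eigenvalueList.2 h)
  have hi' : i ≤ G.diam := by rw [hG.length_eigenvalueList h1] at hi; omega
  exact ⟨i, hi', hG.theta_eq_getElem h1 hi'⟩

theorem theta_lt (h1 : 1 ≤ G.diam) {i j : ℕ} (hij : i < j) (hj : j ≤ G.diam) :
    G.theta j < G.theta i := by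
  rw [hG.theta_eq_getElem h1 hj, hG.theta_eq_getElem h1 (hij.le.trans hj)]
  exact sortedGT_eigenvalueList.getElem_lt_getElem_iff.2 hij

theorem theta_le (h1 : 1 ≤ G.diam) {i j : ℕ} (hij : i ≤ j) (hj : j ≤ G.diam) :
    G.theta j ≤ G.theta i := by
  rcases hij.eq_or_lt with rfl | h
  · exact le_rfl
  · exact (hG.theta_lt h1 h hj).le

theorem theta_diam_sub (h1 : 1 ≤ G.diam) {i : ℕ} (hi : i ≤ G.diam) :
    G.theta (G.diam - i) = -G.theta i := by
  have hlen := hG.length_eigenvalueList h1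
  have hrev : (G.eigenvalueList.map fun t => -t).reverse[G.diam - i]'(by simp [hlen]) =
      G.eigenvalueList[G.diam - i]'(by omega) :=
    List.getElem_of_eq (reverse_map_neg_eigenvalueList hG.bip) _
  rw [hG.theta_eq_getElem h1 (Nat.sub_le _ _), hG.theta_eq_getElem h1 hi, ← hrev,
    List.getElem_reverse, List.getElem_map]
  congr 2
  simp only [List.length_map]
  omega

theorem theta_zero (h1 : 1 ≤ G.diam) : G.theta 0 = G.valency := by
  have := hG.conn.nonempty
  apply le_antisymm
  · exact (le_abs_self _).trans (abs_le_of_mem_spectrum_adjMatrix hG.isRegularOfDegree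
      (hG.theta_mem_spectrum h1 (Nat.zero_le _)))
  · obtain ⟨i, hi, h⟩ := hG.exists_theta_eq h1 (natCast_mem_spectrum_adjMatrix hG.isRegularOfDegree)
    exact h ▸ hG.theta_le h1 (Nat.zero_le _) hi

variable (hodd : Odd G.diam)
include hodd

theorem theta_half_pos : 0 < G.theta (G.diam / 2) := by
  obtain ⟨m, hm⟩ := hodd
  have hneg := hG.theta_diam_sub (by omega) (i := G.diam / 2) (by omega)
  have hlt := hG.theta_lt (by omega) (i := G.diam / 2) (j := G.diam - G.diam / 2) (by omega)
    (by omega)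
  linarith

theorem sq_mem_Icc_theta_sq {μ : ℝ} (hμ : μ ∈ spectrum ℝ (G.adjMatrix ℝ))
    (hne : μ ^ 2 ≠ (G.valency : ℝ) ^ 2) :
    μ ^ 2 ∈ Set.Icc (G.theta (G.diam / 2) ^ 2) (G.theta 1 ^ 2) := by
  have h1 : 1 ≤ G.diam := hodd.pos
  obtain ⟨i, hi, hθ⟩ : ∃ i ≤ G.diam / 2, G.theta i ^ 2 = μ ^ 2 := by
    obtain ⟨i, hi, rfl⟩ := hG.exists_theta_eq h1 hμ
    rcases le_or_gt i (G.diam / 2) with h | h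
    · exact ⟨i, h, rfl⟩
    · exact ⟨G.diam - i, by obtain ⟨m, hm⟩ := hodd; omega, by rw [hG.theta_diam_sub h1 hi, neg_sq]⟩
  have hi0 : 1 ≤ i := Nat.one_le_iff_ne_zero.2 fun h => hne (by rw [← hθ, h, hG.theta_zero h1])
  have hpos := hG.theta_half_pos hodd
  have hhalf := hG.theta_le h1 hi (by omega)
  rw [← hθ]
  exact ⟨pow_le_pow_left₀ hpos.le hhalf 2,
    pow_le_pow_left₀ (hpos.le.trans hhalf) (hG.theta_le h1 hi0 (by omega)) 2⟩

theorem theta_sq_ne {i : ℕ} (h0 : 1 ≤ i) (hi : i ≤ G.diam / 2) :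
    G.theta i ^ 2 ≠ (G.valency : ℝ) ^ 2 := by
  have h1 : 1 ≤ G.diam := hodd.pos
  have hpos := (hG.theta_half_pos hodd).trans_le (hG.theta_le h1 hi (by omega))
  have hlt := hG.theta_lt h1 h0 (show i ≤ G.diam by omega)
  rw [hG.theta_zero h1] at hlt
  exact (pow_lt_pow_left₀ hlt hpos.le two_ne_zero).ne

theorem isExtremalEigenvalue_theta_one (hD : 2 ≤ G.diam) :
    IsExtremalEigenvalue G (G.theta 1) where
  mem := hG.theta_mem_spectrum (by omega) (by omega)
  ne_zero := ((hG.theta_half_pos hodd).trans_le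
    (hG.theta_le (by omega) (show 1 ≤ G.diam / 2 by omega) (by omega))).ne'
  sq_ne := hG.theta_sq_ne hodd le_rfl (by omega)
  exists_sign := ⟨-1, by norm_num, fun μ hμ hne => by
    linarith [(hG.sq_mem_Icc_theta_sq hodd hμ hne).2]⟩

theorem isExtremalEigenvalue_theta_half (hD : 2 ≤ G.diam) :
    IsExtremalEigenvalue G (G.theta (G.diam / 2)) where
  mem := hG.theta_mem_spectrum (by omega) (by omega)
  ne_zero := (hG.theta_half_pos hodd).ne'
  sq_ne := hG.theta_sq_ne hodd (by omega) le_rfl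
  exists_sign := ⟨1, one_ne_zero, fun μ hμ hne => by
    linarith [(hG.sq_mem_Icc_theta_sq hodd hμ hne).1]⟩

end IsBipartiteDRG

end Theta

/-- A (not normalized) cosine sequence of the eigenvalue `θ`: a solution of the three-term
recurrence `c_i e_{i-1} + b_i e_{i+1} = θ e_i`, so that `distKernel G e` is, up to a scalar, the
primitive idempotent of `θ`. -/
structure IsCosineSeq {V : Type*} [Fintype V] (G : SimpleGraph V) (θ : ℝ) (e : ℕ → ℝ) : Prop where
  zero_pos : 0 < e 0
  shift_eq : ∀ i ≤ G.diam, adjShift G e i = θ * e i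

namespace IsBipartiteDRG

section CosineSeq

open Polynomial
open scoped ComplexOrder

variable {V : Type*} [Fintype V] {G : SimpleGraph V} (hG : IsBipartiteDRG G)
include hG

theorem exists_isCosineSeq_posSemidef [DecidableEq V] [DecidableRel G.Adj] {θ : ℝ}
    (hθ : θ ∈ spectrum ℝ (G.adjMatrix ℝ)) :
    ∃ e : ℕ → ℝ, IsCosineSeq G θ e ∧ (distKernel G fun i => (e i : ℂ)).PosSemidef := by
  obtain ⟨g, hF0, hAF⟩ := exists_aeval_ne_zero_and_mul_eq_smul isHermitian_adjMatrix hθ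
  have hFH : (aeval (G.adjMatrix ℝ) g)ᴴ = _ := isHermitian_aeval isHermitian_adjMatrix
  obtain ⟨e, he⟩ := hG.exists_aeval_adjMatrix_eq_distKernel (g * g)
  rw [map_mul] at he
  set F := aeval (G.adjMatrix ℝ) g
  refine ⟨e, ⟨?_, fun i hi => ?_⟩, ?_⟩
  · have htrace : (Fintype.card V : ℝ) * e 0 = (Fᴴ * F).trace := by
      rw [hFH, he, trace_distKernel]
    have hpos : 0 < (Fᴴ * F).trace :=
      (Matrix.posSemidef_conjTranspose_mul_self F).trace_nonneg.lt_of_ne'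
        (Matrix.trace_conjTranspose_mul_self_eq_zero_iff.not.2 hF0)
    exact pos_of_mul_pos_right (htrace ▸ hpos) (Nat.cast_nonneg _)
  · obtain ⟨y, z, rfl⟩ := exists_dist_eq_of_le_diam hG.conn hi
    have hAE : G.adjMatrix ℝ * distKernel G e = θ • distKernel G e := by
      rw [← he, ← mul_assoc, hAF, smul_mul_assoc]
    rw [hG.adjMatrix_mul_distKernel] at hAE
    exact congrFun (congrFun hAE y) z
  · have hmap : distKernel G (fun i => (e i : ℂ)) =
        (F.map Complex.ofRealHom)ᴴ * F.map Complex.ofRealHom := by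
      have hconj (a : ℝ) : Complex.ofRealHom (star a) = star (Complex.ofRealHom a) :=
        (Complex.conj_ofReal a).symm
      rw [← Matrix.conjTranspose_map _ hconj, hFH, ← Matrix.map_mul, he]
      rfl
    rw [hmap]
    exact Matrix.posSemidef_conjTranspose_mul_self _

variable {θ : ℝ} {e : ℕ → ℝ} (he : IsCosineSeq G θ e)
include he

theorem drgB_mul_cosine_sub {i : ℕ} (hi : i + 2 ≤ G.diam) :
    (G.drgB (i + 2) : ℝ) * (e (i + 1) - e (i + 3)) =
      θ * (e i - e (i + 2)) - G.drgC i * (e (i - 1) - e (i + 1)) := by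
  have h1 := he.shift_eq i (by omega)
  have h2 := he.shift_eq (i + 2) hi
  have hk : (G.drgC i + G.drgB i : ℝ) = G.drgC (i + 2) + G.drgB (i + 2) := by
    exact_mod_cast (hG.drgC_add_drgB (by omega)).trans (hG.drgC_add_drgB hi).symm
  simp only [adjShift, show i + 2 - 1 = i + 1 from rfl] at h1 h2
  linear_combination h1 - h2 - e (i + 1) * hk

theorem valency_mul_drgB_one_mul_cosine_sub (hD : 1 ≤ G.diam) :
    (G.valency * G.drgB 1 : ℝ) * (e 0 - e 2) = ((G.valency : ℝ) ^ 2 - θ ^ 2) * e 0 := by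
  have h0 := he.shift_eq 0 (Nat.zero_le _)
  have h1 := he.shift_eq 1 hD
  have hk : (G.drgC 1 + G.drgB 1 : ℝ) = G.valency := by exact_mod_cast hG.drgC_add_drgB hD
  simp only [adjShift, drgC_zero hG.conn, Nat.cast_zero, zero_mul, zero_add,
    show (G.drgB 0 : ℝ) = G.valency from rfl] at h0
  simp only [adjShift, drgC_one hG.drg hD, Nat.cast_one] at h1 hk
  norm_num at h1
  linear_combination (-G.valency : ℝ) * h1 - θ * h0 + (G.valency : ℝ) * e 0 * hk

theorem prod_mul_cosine_sub {i : ℕ} (hi : i + 1 ≤ G.diam) :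
    (∏ j ∈ Finset.range i, (G.drgB (j + 2) : ℝ) / G.drgC (j + 1)) * (e i - e (i + 2)) =
      (distSumPoly G i).eval θ * (e 0 - e 2) := by
  induction i using Nat.twoStepInduction with
  | zero => simp [distSumPoly]
  | one =>
    have h := hG.drgB_mul_cosine_sub he hi
    rw [drgC_zero hG.conn] at h
    simpa [distSumPoly, drgC_one hG.drg (by omega)] using h
  | more i ih ih' =>
    have hc : (G.drgC (i + 1) : ℝ) ≠ 0 := by
      exact_mod_cast (drgC_pos hG.drg (by omega) (by omega)).ne'
    have hc' : (G.drgC (i + 2) : ℝ) ≠ 0 := by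
      exact_mod_cast (drgC_pos hG.drg (by omega) (by omega)).ne'
    have hp := hG.drgC_mul_eval_distSumPoly (show i + 2 ≤ G.diam by omega) θ
    have hrec := hG.drgB_mul_cosine_sub he hi
    rw [Nat.add_sub_cancel] at hrec
    have h0 := ih (by omega)
    have h1 := ih' (by omega)
    rw [Finset.prod_range_succ] at h1
    rw [Finset.prod_range_succ, Finset.prod_range_succ]
    set P := ∏ j ∈ Finset.range i, (G.drgB (j + 2) : ℝ) / G.drgC (j + 1)
    have hQ := div_mul_cancel₀ (G.drgB (i + 2) : ℝ) hc
    have hQ' := div_mul_cancel₀ (G.drgB (i + 3) : ℝ) hc'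
    set Q := (G.drgB (i + 2) : ℝ) / G.drgC (i + 1)
    refine mul_left_cancel₀ hc' ?_
    linear_combination P * Q * (e (i + 2) - e (i + 4)) * hQ' + P * Q * hrec + θ * h1 -
      (G.drgB (i + 2) : ℝ) * h0 - (e 0 - e 2) * hp - P * (e i - e (i + 2)) * hQ

theorem drgB_mul_drgB_mul_cosine_sub (hD : 3 ≤ G.diam) :
    (G.drgB 2 * G.drgB 3 : ℝ) * (e 2 - e 4) = (θ ^ 2 - G.drgB 2) * (e 0 - e 2) := by
  have h1 := hG.drgB_mul_cosine_sub he (i := 0) (by omega)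
  have h2 := hG.drgB_mul_cosine_sub he (i := 1) (by omega)
  rw [drgC_zero hG.conn] at h1
  rw [drgC_one hG.drg (by omega)] at h2
  norm_num at h1 h2
  linear_combination (G.drgB 2 : ℝ) * h2 + θ * h1

variable [DecidableEq V] [DecidableRel G.Adj] (hθ : IsExtremalEigenvalue G θ)
include hθ

theorem cosine_zero_sub_ne_zero (hD : 1 ≤ G.diam) : e 0 - e 2 ≠ 0 := by
  have h := hG.valency_mul_drgB_one_mul_cosine_sub he hD
  exact right_ne_zero_of_mul (h ▸ mul_ne_zero (sub_ne_zero.2 hθ.sq_ne.symm) he.zero_pos.ne')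

theorem cosine_sub_ne_zero {i : ℕ} (hi : i + 2 ≤ G.diam) : e i - e (i + 2) ≠ 0 := by
  have h := hG.prod_mul_cosine_sub he (show i + 1 ≤ G.diam by omega)
  exact right_ne_zero_of_mul (h ▸ mul_ne_zero (hG.eval_distSumPoly_ne_zero hθ hi)
    (hG.cosine_zero_sub_ne_zero he hθ (by omega)))

theorem cosine_zero_sub_four (hD : 4 ≤ G.diam) :
    e 0 - e 4 = -G.tildeVal θ * (e 2 - e 4) := by
  have h := hG.drgB_mul_drgB_mul_cosine_sub he (by omega)
  have hne := hG.sq_ne_drgB_two hθ hD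
  rw [SimpleGraph.tildeVal]
  field_simp
  linear_combination -h

end CosineSeq

end IsBipartiteDRG

section SphereBlock

variable {V : Type*}

/-- The block `E_i^* M E_j^*` of `M = distKernel G e` between the spheres of radii `i` and `j`
around `x`. -/
noncomputable def sphereBlock (G : SimpleGraph V) (x : V) (i j : ℕ) :
    (ℕ → ℂ) →ₗ[ℂ] Matrix V V ℂ where
  toFun e := Matrix.of fun y z => if G.dist x y = i ∧ G.dist x z = j then e (G.dist y z) else 0
  map_add' e f := by
    ext
    exact (ite_add_zero (P := _ ∧ _)).trans rfl
  map_smul' a e := by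
    ext
    exact (smul_ite_zero (_ ∧ _) a _).symm.trans rfl

variable {G : SimpleGraph V} (x : V) (i j h : ℕ)

theorem sphereBlock_apply (e : ℕ → ℂ) (y z : V) : sphereBlock G x i j e y z =
    if G.dist x y = i ∧ G.dist x z = j then e (G.dist y z) else 0 := rfl

theorem sphereBlock_conjTranspose (e : ℕ → ℂ) :
    (sphereBlock G x i j e)ᴴ = sphereBlock G x j i (star e) := by
  ext y z
  simp only [Matrix.conjTranspose_apply, sphereBlock_apply, apply_ite star, star_zero, and_comm,
    G.dist_comm (u := z) (v := y), Pi.star_apply]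

theorem sphereBlock_single_zero [DecidableEq V] (hG : G.Connected) :
    sphereBlock G x i i (Pi.single 0 1) = G.dualIdem x i := by
  ext y z
  simp only [sphereBlock_apply, SimpleGraph.dualIdem, Matrix.diagonal_apply, Pi.single_apply,
    hG.dist_eq_zero_iff]
  grind

variable [Fintype V]

theorem dualIdem_mul_distKernel_mul_dualIdem [DecidableEq V] (e : ℕ → ℂ) :
    G.dualIdem x i * distKernel G e * G.dualIdem x j = sphereBlock G x i j e := by
  ext y z
  rw [SimpleGraph.dualIdem, SimpleGraph.dualIdem, Matrix.mul_diagonal, Matrix.diagonal_mul,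
    distKernel_apply, sphereBlock_apply]
  split_ifs <;> simp_all

theorem sphereBlock_mul_sphereBlock_apply (e f : ℕ → ℂ) (y z : V) :
    (sphereBlock G x i j e * sphereBlock G x j h f) y z =
      if G.dist x y = i ∧ G.dist x z = h then
        ∑ w with G.dist x w = j, e (G.dist y w) * f (G.dist w z) else 0 := by
  simp only [Matrix.mul_apply, sphereBlock_apply, Finset.sum_filter]
  split_ifs with hyz
  · exact Finset.sum_congr rfl fun w _ => by grind
  · exact Finset.sum_eq_zero fun w _ => by grind

end SphereBlock

namespace IsBipartiteDRG

section SphereBlock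

variable {V : Type*} [Fintype V] {G : SimpleGraph V} (hG : IsBipartiteDRG G)
include hG

variable (x : V) (i j h : ℕ)

theorem sphereBlock_congr {i j : ℕ} {e f : ℕ → ℂ}
    (hef : ∀ m, (i + m + j) % 2 = 0 → j ≤ i + m → i ≤ j + m → m ≤ i + j → e m = f m) :
    sphereBlock G x i j e = sphereBlock G x i j f := by
  ext y z
  rw [sphereBlock_apply, sphereBlock_apply]
  refine if_ctx_congr Iff.rfl (fun ⟨hy, hz⟩ => hef _ ?_ ?_ ?_ ?_) fun _ => rfl
  · exact hy ▸ hz ▸ hG.even_dist x y z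
  · exact hy ▸ hz ▸ hG.dist_tri x y z
  · exact by rw [← hy, ← hz, G.dist_comm (u := y)]; exact hG.dist_tri x z y
  · exact by rw [← hy, ← hz, G.dist_comm (u := x) (v := y)]; exact hG.dist_tri y x z

theorem card_dist_eq : Finset.card {w | G.dist x w = i} = G.interNum 0 i i := by
  rw [← G.dist_self (v := x), ← distCount_eq_interNum hG.drg, SimpleGraph.distCount]
  simp only [G.dist_comm (v := x), and_self]

theorem trace_sphereBlock (e : ℕ → ℂ) :
    (sphereBlock G x i i e).trace = G.interNum 0 i i * e 0 := by
  simp only [Matrix.trace, Matrix.diag_apply, sphereBlock_apply, and_self, G.dist_self,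
    ← Finset.sum_filter, Finset.sum_const, hG.card_dist_eq, nsmul_eq_mul]

theorem sphereBlock_one_mul_one : sphereBlock G x i j 1 * sphereBlock G x j h 1 =
    (G.interNum 0 j j : ℂ) • sphereBlock G x i h 1 := by
  ext y z
  rw [sphereBlock_mul_sphereBlock_apply, Matrix.smul_apply, sphereBlock_apply]
  simp [hG.card_dist_eq]

theorem sphereBlock_single_mul_one (m : ℕ) :
    sphereBlock G x i j (Pi.single m 1) * sphereBlock G x j h 1 =
      (G.interNum i m j : ℂ) • sphereBlock G x i h 1 := by
  ext y z
  rw [sphereBlock_mul_sphereBlock_apply, Matrix.smul_apply, sphereBlock_apply, smul_ite,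
    smul_zero]
  refine if_ctx_congr Iff.rfl (fun ⟨hy, _⟩ => ?_) fun _ => rfl
  rw [← hy, G.dist_comm, ← distCount_eq_interNum hG.drg, SimpleGraph.distCount]
  simp [Pi.single_apply, Finset.filter_filter, G.dist_comm (u := x), and_comm]

theorem trace_sphereBlock_single_mul_single (m : ℕ) :
    (sphereBlock G x i j (Pi.single m 1) * sphereBlock G x j i (Pi.single m 1)).trace =
      G.interNum i m j * G.interNum 0 i i := by
  have hentry (y : V) (hy : G.dist x y = i) :
      ∑ w with G.dist x w = j, (Pi.single m 1 : ℕ → ℂ) (G.dist y w) *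
        (Pi.single m 1 : ℕ → ℂ) (G.dist w y) = G.interNum i m j := by
    rw [← hy, G.dist_comm (u := x) (v := y), ← distCount_eq_interNum hG.drg, SimpleGraph.distCount]
    simp [Pi.single_apply, ← Finset.sum_filter, Finset.filter_filter, G.dist_comm (u := x),
      G.dist_comm (v := y), and_comm]
  simp only [Matrix.trace, Matrix.diag_apply, sphereBlock_mul_sphereBlock_apply, and_self,
    ← Finset.sum_filter]
  rw [Finset.sum_congr rfl fun y hy => hentry y (Finset.mem_filter.1 hy).2, Finset.sum_const,
    hG.card_dist_eq, nsmul_eq_mul, mul_comm]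

/-- The neighbours of a vertex adjacent to `x` are `x` itself and vertices at distance two. -/
theorem sphereBlock_mul_single_one (e : ℕ → ℂ) :
    sphereBlock G x i 2 e * sphereBlock G x 2 1 (Pi.single 1 1) =
      sphereBlock G x i 1 (adjShift G e - fun _ => e i) := by
  classical
  ext y z
  rw [sphereBlock_mul_sphereBlock_apply, sphereBlock_apply]
  refine if_ctx_congr Iff.rfl (fun ⟨hy, hz⟩ => ?_) fun _ => rfl
  have hx : x ∈ Finset.univ.filter fun w => G.dist z w = 1 :=
    (Finset.mem_filter_univ x).2 (G.dist_comm.trans hz)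
  have hsphere : ({w | G.dist x w = 2 ∧ G.dist w z = 1} : Finset V) =
      ({w | G.dist z w = 1} : Finset V).erase x := by
    ext w
    have h1 := hG.even_dist x z w
    have h2 := hG.dist_tri x z w
    have h3 := hG.conn.dist_eq_zero_iff (u := x) (v := w)
    simp only [Finset.mem_filter_univ, Finset.mem_erase, G.dist_comm (v := z)]
    grind
  have hsum := hG.sum_dist_eq_one e z y
  rw [nsmul_eq_mul, nsmul_eq_mul] at hsum
  simp only [Pi.single_apply, mul_ite, mul_one, mul_zero, ← Finset.sum_filter,
    Finset.filter_filter, hsphere, Pi.sub_apply, adjShift]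
  rw [G.dist_comm (u := y), ← hsum, ← hy, ← Finset.add_sum_erase _ _ hx, add_sub_cancel_left]
  simp only [G.dist_comm (v := y)]

end SphereBlock

end IsBipartiteDRG

section LocalProj

variable {V : Type*} (G : SimpleGraph V) (x : V)

/-- The matrix `E_2^* A_2 E_2^*` of the distance-two graph on the sphere of radius two around
`x`. -/
noncomputable def localMat : Matrix V V ℂ :=
  sphereBlock G x 2 2 (Pi.single 2 1)

/-- The matrix `E_2^* A E_1^*` of adjacencies between the spheres of radii two and one around
`x`. -/
noncomputable def sphereIncidence : Matrix V V ℂ :=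
  sphereBlock G x 2 1 (Pi.single 1 1)

variable [Fintype V] [DecidableEq V]

/-- The orthogonal projection onto the orthogonal complement of the range of `sphereIncidence G x`
within the vectors supported on the sphere of radius two around `x`. For an irreducible
`T(x)`-module `W` it is zero on `E_2^* W` if the endpoint is less than two, and the identity there
if the endpoint is two. -/
noncomputable def localProj : Matrix V V ℂ :=
  G.dualIdem x 2 - (G.drgB 2 : ℂ)⁻¹ • (sphereIncidence G x * (sphereIncidence G x)ᴴ) +
    ((G.drgC 2 - 1) * G.drgC 2 / (G.drgB 1 * G.drgB 2) : ℂ) • sphereBlock G x 2 2 1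

variable {G}

omit [Fintype V] in
theorem dualIdem_conjTranspose (i : ℕ) : (G.dualIdem x i)ᴴ = G.dualIdem x i := by
  rw [SimpleGraph.dualIdem, Matrix.diagonal_conjTranspose]
  exact congrArg _ (funext fun y => by simp [apply_ite])

theorem dualIdem_mul_sphereBlock (i j : ℕ) (e : ℕ → ℂ) :
    G.dualIdem x i * sphereBlock G x i j e = sphereBlock G x i j e := by
  ext y z
  rw [SimpleGraph.dualIdem, Matrix.diagonal_mul, sphereBlock_apply]
  split_ifs <;> simp_all

theorem sphereBlock_mul_dualIdem (i j : ℕ) (e : ℕ → ℂ) :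
    sphereBlock G x i j e * G.dualIdem x j = sphereBlock G x i j e := by
  ext y z
  rw [SimpleGraph.dualIdem, Matrix.mul_diagonal, sphereBlock_apply]
  split_ifs <;> simp_all

theorem dualIdem_mul_self (i : ℕ) : G.dualIdem x i * G.dualIdem x i = G.dualIdem x i := by
  simp [SimpleGraph.dualIdem]

theorem localMat_eq : localMat G x = G.dualIdem x 2 * G.distMatrix 2 * G.dualIdem x 2 := by
  rw [localMat, ← dualIdem_mul_distKernel_mul_dualIdem]
  congr 2
  ext y z
  simp [distKernel_apply, SimpleGraph.distMatrix, Pi.single_apply]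

omit [Fintype V] [DecidableEq V] in
theorem localMat_conjTranspose : (localMat G x)ᴴ = localMat G x := by
  rw [localMat, sphereBlock_conjTranspose]
  simp

omit [Fintype V] [DecidableEq V] in
theorem sphereIncidence_conjTranspose :
    (sphereIncidence G x)ᴴ = sphereBlock G x 1 2 (Pi.single 1 1) := by
  rw [sphereIncidence, sphereBlock_conjTranspose]
  simp

theorem localProj_conjTranspose : (localProj G x)ᴴ = localProj G x := by
  simp [localProj, dualIdem_conjTranspose, sphereBlock_conjTranspose]

theorem localProj_mul_dualIdem : localProj G x * G.dualIdem x 2 = localProj G x := by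
  rw [localProj, add_mul, sub_mul, smul_mul_assoc, smul_mul_assoc, mul_assoc,
    sphereIncidence_conjTranspose, sphereBlock_mul_dualIdem, sphereBlock_mul_dualIdem,
    dualIdem_mul_self]

theorem dualIdem_mul_localProj : G.dualIdem x 2 * localProj G x = localProj G x := by
  simpa [localProj_conjTranspose, dualIdem_conjTranspose] using
    congrArg Matrix.conjTranspose (localProj_mul_dualIdem (G := G) x)

theorem mul_localProj_of_mul_eq_zero {M : Matrix V V ℂ} (hN : M * sphereIncidence G x = 0)
    (hJ : M * sphereBlock G x 2 2 1 = 0) : M * localProj G x = M * G.dualIdem x 2 := by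
  rw [localProj, mul_add, mul_sub, mul_smul_comm, mul_smul_comm, ← mul_assoc, hN, hJ]
  simp

end LocalProj

namespace IsBipartiteDRG

section LocalProj

variable {V : Type*} [Fintype V] {G : SimpleGraph V} (hG : IsBipartiteDRG G)
include hG

theorem cast_valency_eq (hD : 1 ≤ G.diam) : (G.valency : ℂ) = G.drgB 1 + 1 := by
  rw [← hG.drgC_add_drgB hD, drgC_one hG.drg hD, Nat.cast_add, Nat.cast_one, add_comm]

theorem cast_drgB_eq {i : ℕ} (hi : i ≤ G.diam) : (G.drgB i : ℂ) = G.valency - G.drgC i := by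
  rw [← hG.drgC_add_drgB hi, Nat.cast_add, add_sub_cancel_left]

theorem cast_drgC_ne_zero {i : ℕ} (h1 : 1 ≤ i) (hi : i ≤ G.diam) : (G.drgC i : ℂ) ≠ 0 :=
  Nat.cast_ne_zero.2 (drgC_pos hG.drg h1 hi).ne'

theorem cast_drgB_ne_zero {i : ℕ} (hi : i < G.diam) : (G.drgB i : ℂ) ≠ 0 :=
  Nat.cast_ne_zero.2 (drgB_pos hG.drg hi).ne'

variable (x : V)

theorem conjTranspose_sphereIncidence_mul_self [DecidableEq V] (hD : 2 ≤ G.diam) :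
    (sphereIncidence G x)ᴴ * sphereIncidence G x =
      (G.drgB 2 : ℂ) • G.dualIdem x 1 + (G.drgC 2 - 1 : ℂ) • sphereBlock G x 1 1 1 := by
  have hk : (G.drgC 2 + G.drgB 2 : ℂ) = G.drgB 0 := by exact_mod_cast hG.drgC_add_drgB hD
  rw [sphereIncidence_conjTranspose, sphereIncidence, hG.sphereBlock_mul_single_one,
    ← sphereBlock_single_zero x 1 hG.conn, ← map_smul, ← map_smul, ← map_add]
  refine hG.sphereBlock_congr x fun m hm _ _ hm2 => ?_
  obtain rfl | rfl : m = 0 ∨ m = 2 := by omega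
  · simp [adjShift, drgC_zero hG.conn, ← hk]
    ring
  · simp [adjShift]

theorem localMat_mul_sphereIncidence (hD : 1 ≤ G.diam) :
    localMat G x * sphereIncidence G x = (G.drgB 1 - G.drgC 3 : ℂ) • sphereIncidence G x +
      (G.drgC 3 - 1 : ℂ) • sphereBlock G x 2 1 1 := by
  rw [localMat, sphereIncidence, hG.sphereBlock_mul_single_one, ← map_smul, ← map_smul, ← map_add]
  refine hG.sphereBlock_congr x fun m hm _ hm1 hm3 => ?_
  obtain rfl | rfl : m = 1 ∨ m = 3 := by omega
  · simp [adjShift, drgC_one hG.drg hD]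
  · simp [adjShift]

theorem sphereIncidence_mul_one (h : ℕ) :
    sphereIncidence G x * sphereBlock G x 1 h 1 = (G.drgC 2 : ℂ) • sphereBlock G x 2 h 1 :=
  hG.sphereBlock_single_mul_one x 2 1 h 1

theorem conjTranspose_sphereIncidence_mul_one (h : ℕ) :
    (sphereIncidence G x)ᴴ * sphereBlock G x 2 h 1 = (G.drgB 1 : ℂ) • sphereBlock G x 1 h 1 := by
  rw [sphereIncidence_conjTranspose]
  exact hG.sphereBlock_single_mul_one x 1 2 h 1

theorem one_mul_sphereIncidence :
    sphereBlock G x 2 2 1 * sphereIncidence G x = (G.drgB 1 : ℂ) • sphereBlock G x 2 1 1 := by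
  classical
  simpa [sphereBlock_conjTranspose] using
    congrArg Matrix.conjTranspose (hG.conjTranspose_sphereIncidence_mul_one x 2)

theorem localMat_mul_one (h : ℕ) : localMat G x * sphereBlock G x 2 h 1 =
    (G.interNum 2 2 2 : ℂ) • sphereBlock G x 2 h 1 :=
  hG.sphereBlock_single_mul_one x 2 2 h 2

variable [DecidableEq V]

theorem localProj_mul_sphereIncidence (hD : 3 ≤ G.diam) :
    localProj G x * sphereIncidence G x = 0 := by
  have hb1 := hG.cast_drgB_ne_zero (i := 1) (by omega)
  have hb2 := hG.cast_drgB_ne_zero (i := 2) (by omega)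
  rw [localProj, add_mul, sub_mul, smul_mul_assoc, smul_mul_assoc, mul_assoc,
    hG.conjTranspose_sphereIncidence_mul_self x (by omega), hG.one_mul_sphereIncidence, mul_add,
    mul_smul_comm, mul_smul_comm, hG.sphereIncidence_mul_one, sphereIncidence,
    dualIdem_mul_sphereBlock, sphereBlock_mul_dualIdem]
  match_scalars
  · field_simp
    ring
  · field_simp
    ring

theorem localProj_mul_one (hD : 3 ≤ G.diam) (h : ℕ) :
    localProj G x * sphereBlock G x 2 h 1 = 0 := by
  have hc2 := hG.cast_drgC_ne_zero (i := 2) (by omega) (by omega)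
  refine (smul_eq_zero.1 ?_).resolve_left hc2
  rw [← mul_smul_comm, ← hG.sphereIncidence_mul_one, ← mul_assoc,
    hG.localProj_mul_sphereIncidence x hD, zero_mul]

theorem localProj_mul_self (hD : 3 ≤ G.diam) :
    localProj G x * localProj G x = localProj G x := by
  rw [mul_localProj_of_mul_eq_zero x (hG.localProj_mul_sphereIncidence x hD)
    (hG.localProj_mul_one x hD 2), localProj_mul_dualIdem]

theorem localProj_mul_localMat (hD : 3 ≤ G.diam) :
    localProj G x * localMat G x = localMat G x * localProj G x := by
  have hN : localProj G x * localMat G x * sphereIncidence G x = 0 := by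
    rw [mul_assoc, hG.localMat_mul_sphereIncidence x (by omega), mul_add, mul_smul_comm,
      mul_smul_comm, hG.localProj_mul_sphereIncidence x hD, hG.localProj_mul_one x hD, smul_zero,
      smul_zero, add_zero]
  have hJ : localProj G x * localMat G x * sphereBlock G x 2 2 1 = 0 := by
    rw [mul_assoc, hG.localMat_mul_one, mul_smul_comm, hG.localProj_mul_one x hD, smul_zero]
  have hPBP : localProj G x * localMat G x * localProj G x = localProj G x * localMat G x := by
    rw [mul_localProj_of_mul_eq_zero x hN hJ, mul_assoc, localMat, sphereBlock_mul_dualIdem]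
  have h := congrArg Matrix.conjTranspose hPBP
  simp only [Matrix.conjTranspose_mul, localProj_conjTranspose, localMat_conjTranspose] at h
  rw [← h, ← mul_assoc, hPBP]

end LocalProj

end IsBipartiteDRG

section LocalTrace

variable {V : Type*} [Fintype V] [DecidableEq V] {G : SimpleGraph V}

theorem trace_mul_localProj (x : V) (M : Matrix V V ℂ) : (M * localProj G x).trace =
    (M * G.dualIdem x 2).trace -
      (G.drgB 2 : ℂ)⁻¹ * ((sphereIncidence G x)ᴴ * (M * sphereIncidence G x)).trace +
      (G.drgC 2 - 1) * G.drgC 2 / (G.drgB 1 * G.drgB 2) * (M * sphereBlock G x 2 2 1).trace := by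
  rw [localProj, mul_add, mul_sub, mul_smul_comm, mul_smul_comm, Matrix.trace_add,
    Matrix.trace_sub, Matrix.trace_smul, Matrix.trace_smul, ← mul_assoc,
    Matrix.trace_mul_comm (M * _), smul_eq_mul, smul_eq_mul]

end LocalTrace

namespace IsBipartiteDRG

section LocalTrace

variable {V : Type*} [Fintype V] {G : SimpleGraph V} (hG : IsBipartiteDRG G)
include hG

theorem drgC_two_mul_interNum_zero : (G.drgC 2 * G.interNum 0 2 2 : ℂ) =
    G.valency * G.drgB 1 := by
  obtain ⟨x⟩ := hG.conn.nonempty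
  have h := Matrix.trace_mul_comm (sphereIncidence G x) (sphereIncidence G x)ᴴ
  rw [sphereIncidence_conjTranspose, sphereIncidence, hG.trace_sphereBlock_single_mul_single,
    hG.trace_sphereBlock_single_mul_single] at h
  exact h.trans (mul_comm _ _)

theorem interNum_zero_two_ne_zero (hD : 2 ≤ G.diam) : (G.interNum 0 2 2 : ℂ) ≠ 0 :=
  right_ne_zero_of_mul (hG.drgC_two_mul_interNum_zero ▸
    mul_ne_zero (hG.cast_drgB_ne_zero (i := 0) (by omega)) (hG.cast_drgB_ne_zero (by omega)))

theorem drgC_two_mul_interNum_two (hD : 2 ≤ G.diam) : (G.drgC 2 * G.interNum 2 2 2 : ℂ) =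
    (G.drgB 1 - G.drgC 3) * G.drgC 2 + (G.drgC 3 - 1) * G.valency := by
  obtain ⟨x⟩ := hG.conn.nonempty
  have h : (G.drgC 2 * G.interNum 2 2 2 : ℂ) • sphereBlock G x 2 2 1 =
      ((G.drgB 1 - G.drgC 3) * G.drgC 2 + (G.drgC 3 - 1) * G.valency : ℂ) •
        sphereBlock G x 2 2 1 := by
    rw [mul_smul, ← hG.localMat_mul_one, ← mul_smul_comm, ← hG.sphereIncidence_mul_one,
      ← mul_assoc, hG.localMat_mul_sphereIncidence x (by omega), add_mul, smul_mul_assoc,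
      smul_mul_assoc, hG.sphereIncidence_mul_one, hG.sphereBlock_one_mul_one, smul_smul,
      smul_smul, ← add_smul]
    rfl
  have htrace := congrArg Matrix.trace h
  rw [Matrix.trace_smul, Matrix.trace_smul, hG.trace_sphereBlock, Pi.one_apply, mul_one,
    smul_eq_mul, smul_eq_mul] at htrace
  exact mul_right_cancel₀ (hG.interNum_zero_two_ne_zero hD) htrace

variable (x : V)

theorem trace_sphereBlock_two_one : (sphereBlock G x 2 2 1).trace = G.interNum 0 2 2 := by
  rw [hG.trace_sphereBlock, Pi.one_apply, mul_one]

theorem trace_localMat_mul_self : (localMat G x * localMat G x).trace =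
    G.interNum 2 2 2 * G.interNum 0 2 2 :=
  hG.trace_sphereBlock_single_mul_single x 2 2 2

theorem trace_conjTranspose_sphereIncidence_mul_self :
    ((sphereIncidence G x)ᴴ * sphereIncidence G x).trace = G.valency * G.drgB 1 := by
  rw [sphereIncidence_conjTranspose, sphereIncidence, hG.trace_sphereBlock_single_mul_single,
    mul_comm]
  rfl

theorem trace_conjTranspose_sphereIncidence_mul_one :
    ((sphereIncidence G x)ᴴ * sphereBlock G x 2 1 1).trace = G.valency * G.drgB 1 := by
  rw [hG.conjTranspose_sphereIncidence_mul_one, Matrix.trace_smul, hG.trace_sphereBlock,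
    Pi.one_apply, mul_one, smul_eq_mul, mul_comm]
  rfl

variable [DecidableEq V]

theorem trace_localProj (hD : 3 ≤ G.diam) :
    (localProj G x).trace = G.interNum 0 2 2 - G.valency := by
  have hb1 := hG.cast_drgB_ne_zero (i := 1) (by omega)
  have hb2 := hG.cast_drgB_ne_zero (i := 2) (by omega)
  have htrace := trace_mul_localProj (G := G) x 1
  rw [one_mul, one_mul, one_mul, one_mul, hG.trace_conjTranspose_sphereIncidence_mul_self,
    ← sphereBlock_single_zero x 2 hG.conn, hG.trace_sphereBlock, hG.trace_sphereBlock_two_one,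
    Pi.single_eq_same, mul_one] at htrace
  rw [htrace]
  field_simp
  linear_combination (G.drgC 2 - 1 : ℂ) * hG.drgC_two_mul_interNum_zero +
    G.valency * G.drgB 1 * (hG.cast_valency_eq (by omega) + hG.cast_drgB_eq (i := 2) (by omega))

theorem trace_localMat_mul_localProj (hD : 3 ≤ G.diam) : (localMat G x * localProj G x).trace =
    -(G.interNum 2 2 2 + G.drgB 1 * (G.drgB 3 - 1)) := by
  have hb1 := hG.cast_drgB_ne_zero (i := 1) (by omega)
  have hb2 := hG.cast_drgB_ne_zero (i := 2) (by omega)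
  rw [trace_mul_localProj, hG.localMat_mul_sphereIncidence x (by omega), hG.localMat_mul_one,
    mul_add, mul_smul_comm, mul_smul_comm, Matrix.trace_add, Matrix.trace_smul,
    Matrix.trace_smul, Matrix.trace_smul, hG.trace_conjTranspose_sphereIncidence_mul_self,
    hG.trace_conjTranspose_sphereIncidence_mul_one, hG.trace_sphereBlock_two_one, localMat,
    sphereBlock_mul_dualIdem, hG.trace_sphereBlock]
  have hk := hG.cast_valency_eq (by omega)
  have hc2 := hG.cast_drgC_ne_zero (i := 2) (by omega) (by omega)
  have h2 := hG.cast_drgB_eq (i := 2) (by omega)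
  have h3 := hG.cast_drgB_eq (i := 3) (by omega)
  have hk2 := eq_div_of_mul_eq hc2 ((mul_comm _ _).trans hG.drgC_two_mul_interNum_zero)
  have hp := eq_div_of_mul_eq hc2 ((mul_comm _ _).trans (hG.drgC_two_mul_interNum_two (by omega)))
  rw [hk] at h2 h3 hk2 hp
  rw [h2] at hb2
  simp only [Pi.single_apply, OfNat.zero_ne_ofNat, if_false, smul_eq_mul, hk2, hp, h2, h3, hk]
  field_simp
  ring

theorem trace_localMat_mul_localMat_mul_localProj (hD : 3 ≤ G.diam) :
    (localMat G x * (localMat G x * localProj G x)).trace =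
      G.interNum 0 2 2 * G.interNum 2 2 2 - G.interNum 2 2 2 ^ 2 -
        G.drgB 1 * (G.drgB 3 - 1) ^ 2 := by
  have hb1 := hG.cast_drgB_ne_zero (i := 1) (by omega)
  have hb2 := hG.cast_drgB_ne_zero (i := 2) (by omega)
  have hdual : localMat G x * G.dualIdem x 2 = localMat G x := sphereBlock_mul_dualIdem ..
  have hincidence : localMat G x * (localMat G x * sphereIncidence G x) =
      ((G.drgB 1 - G.drgC 3) ^ 2 : ℂ) • sphereIncidence G x +
        ((G.drgC 3 - 1) * (G.drgB 1 - G.drgC 3 + G.interNum 2 2 2) : ℂ) •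
          sphereBlock G x 2 1 1 := by
    rw [hG.localMat_mul_sphereIncidence x (by omega), mul_add, mul_smul_comm, mul_smul_comm,
      hG.localMat_mul_sphereIncidence x (by omega), hG.localMat_mul_one]
    module
  rw [← mul_assoc, trace_mul_localProj, mul_assoc, mul_assoc, mul_assoc, hdual, hincidence,
    hG.localMat_mul_one, mul_smul_comm, hG.localMat_mul_one,
    mul_add, mul_smul_comm, mul_smul_comm, Matrix.trace_add, Matrix.trace_smul,
    Matrix.trace_smul, Matrix.trace_smul, Matrix.trace_smul,
    hG.trace_conjTranspose_sphereIncidence_mul_self, hG.trace_localMat_mul_self,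
    hG.trace_conjTranspose_sphereIncidence_mul_one, hG.trace_sphereBlock_two_one]
  have hk := hG.cast_valency_eq (by omega)
  have hc2 := hG.cast_drgC_ne_zero (i := 2) (by omega) (by omega)
  have h2 := hG.cast_drgB_eq (i := 2) (by omega)
  have h3 := hG.cast_drgB_eq (i := 3) (by omega)
  have hk2 := eq_div_of_mul_eq hc2 ((mul_comm _ _).trans hG.drgC_two_mul_interNum_zero)
  have hp := eq_div_of_mul_eq hc2 ((mul_comm _ _).trans (hG.drgC_two_mul_interNum_two (by omega)))
  rw [hk] at h2 h3 hk2 hp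
  rw [h2] at hb2
  simp only [smul_eq_mul, hk2, hp, h2, h3, hk]
  field_simp
  ring

end LocalTrace

end IsBipartiteDRG

section TautMat

variable {V : Type*} [Fintype V] [DecidableEq V] (G : SimpleGraph V) (x : V)

/-- The matrix `(B - η)(B - η')P` with `B = E_2^* A_2 E_2^*` and `P = localProj G x`. It vanishes
if and only if `B` has no eigenvalues other than `η` and `η'` on the range of `P`. -/
noncomputable def tautMat (η η' : ℝ) : Matrix V V ℂ :=
  (localMat G x - (η : ℂ) • 1) * ((localMat G x - (η' : ℂ) • 1) * localProj G x)

variable {G}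

theorem trace_tautMat (η η' : ℝ) : (tautMat G x η η').trace =
    (localMat G x * (localMat G x * localProj G x)).trace -
      (η + η') * (localMat G x * localProj G x).trace + η * η' * (localProj G x).trace := by
  simp only [tautMat, sub_mul, mul_sub, smul_mul_assoc, one_mul, mul_smul_comm, Matrix.trace_sub,
    Matrix.trace_smul, smul_eq_mul]
  ring

end TautMat

namespace IsBipartiteDRG

section TautMat

variable {V : Type*} [Fintype V] [DecidableEq V] {G : SimpleGraph V} (hG : IsBipartiteDRG G)
include hG
variable (x : V)

theorem sphereBlock_two_two_eq (e : ℕ → ℂ) : sphereBlock G x 2 2 e =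
    (e 0 - e 4) • G.dualIdem x 2 + (e 2 - e 4) • localMat G x +
      e 4 • sphereBlock G x 2 2 1 := by
  rw [← sphereBlock_single_zero x 2 hG.conn, localMat, ← map_smul, ← map_smul, ← map_smul,
    ← map_add, ← map_add]
  refine hG.sphereBlock_congr x fun m hm _ _ hm4 => ?_
  obtain rfl | rfl | rfl : m = 0 ∨ m = 2 ∨ m = 4 := by omega
  · simp
  · simp
  · simp

theorem localProj_mul_distKernel_mul_localProj (hD : 3 ≤ G.diam) (e : ℕ → ℂ) :
    localProj G x * distKernel G e * localProj G x =
      ((e 0 - e 4) • 1 + (e 2 - e 4) • localMat G x) * localProj G x := by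
  have hblock : localProj G x * distKernel G e * localProj G x =
      localProj G x * sphereBlock G x 2 2 e * localProj G x := by
    rw [← dualIdem_mul_distKernel_mul_dualIdem, ← mul_assoc, ← mul_assoc, localProj_mul_dualIdem,
      mul_assoc _ (G.dualIdem x 2), dualIdem_mul_localProj]
  rw [hblock, hG.sphereBlock_two_two_eq, mul_add, mul_add, mul_smul_comm, mul_smul_comm,
    mul_smul_comm, hG.localProj_mul_one x hD, localProj_mul_dualIdem,
    hG.localProj_mul_localMat x hD, smul_zero, add_zero, add_mul, smul_mul_assoc, smul_mul_assoc,
    mul_assoc, hG.localProj_mul_self x hD, add_mul, smul_mul_assoc, smul_mul_assoc, one_mul]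

open scoped ComplexOrder in
theorem localProj_eq_zero_of_drgB_two_eq_one (hD : 4 ≤ G.diam) (hb2 : G.drgB 2 = 1) :
    localProj G x = 0 := by
  have hc2 : (G.drgC 2 : ℂ) = G.drgB 1 := by
    have h2 := hG.cast_drgB_eq (i := 2) (by omega)
    rw [hb2, Nat.cast_one] at h2
    linear_combination hG.cast_valency_eq (by omega) + h2
  have hk2 : (G.interNum 0 2 2 : ℂ) = G.valency := by
    have h := hG.drgC_two_mul_interNum_zero
    rw [hc2, mul_comm] at h
    exact mul_right_cancel₀ (hG.cast_drgB_ne_zero (by omega)) h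
  rw [← Matrix.trace_conjTranspose_mul_self_eq_zero_iff, localProj_conjTranspose,
    hG.localProj_mul_self x (by omega), hG.trace_localProj x (by omega), hk2, sub_self]

omit [DecidableEq V] in
theorem drgB_two_ne_one (hD : 4 ≤ G.diam) (hk : 3 ≤ G.valency) : G.drgB 2 ≠ 1 := by
  classical
  intro hb2
  obtain ⟨x⟩ := hG.conn.nonempty
  have htrace := hG.trace_localMat_mul_localProj x (by omega)
  rw [hG.localProj_eq_zero_of_drgB_two_eq_one x hD hb2, mul_zero, Matrix.trace_zero, eq_comm,
    neg_eq_zero] at htrace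
  have hb1 : 0 < G.drgB 1 := drgB_pos hG.drg (by omega)
  have hb3 : 1 ≤ G.drgB 3 := drgB_pos hG.drg (by omega)
  obtain ⟨hp0, hb3'⟩ : G.interNum 2 2 2 = 0 ∧ G.drgB 1 * (G.drgB 3 - 1) = 0 := by
    rw [← Nat.add_eq_zero_iff, ← Nat.cast_eq_zero (R := ℂ)]
    push_cast [hb3]
    exact htrace
  have hc3 : (G.drgC 3 : ℂ) = G.drgB 1 := by
    have h3 := hG.cast_drgB_eq (i := 3) (by omega)
    have hb3_one : G.drgB 3 = 1 := by
      have := (mul_eq_zero.1 hb3').resolve_left hb1.ne'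
      omega
    rw [hb3_one, Nat.cast_one] at h3
    linear_combination hG.cast_valency_eq (by omega) + h3
  have hp := hG.drgC_two_mul_interNum_two (by omega)
  rw [hp0, hc3, sub_self, Nat.cast_zero, mul_zero, zero_mul, zero_add, eq_comm] at hp
  have hk2 := sub_eq_zero.1 <|
    (mul_eq_zero.1 hp).resolve_right (hG.cast_drgB_ne_zero (i := 0) (by omega))
  have hk1 := hG.cast_valency_eq (by omega)
  norm_cast at hk1 hk2
  omega

variable [DecidableRel G.Adj]

open scoped ComplexOrder in
theorem exists_posSemidef_eq_smul_mul_localProj (hD : 4 ≤ G.diam) {θ : ℝ}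
    (hθ : IsExtremalEigenvalue G θ) : ∃ e : ℕ → ℂ, (∀ i, i + 2 ≤ G.diam → e i ≠ e (i + 2)) ∧
      (distKernel G e).PosSemidef ∧ ∃ κ : ℂ, κ ≠ 0 ∧
      localProj G x * distKernel G e * localProj G x =
        κ • ((localMat G x - (G.tildeVal θ : ℂ) • 1) * localProj G x) := by
  obtain ⟨e, he, hpos⟩ := hG.exists_isCosineSeq_posSemidef hθ.mem
  refine ⟨_, fun i hi => ?_, hpos, ((e 2 - e 4 : ℝ) : ℂ), ?_, ?_⟩
  · exact Complex.ofReal_injective.ne (sub_ne_zero.1 (hG.cosine_sub_ne_zero he hθ hi))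
  · exact Complex.ofReal_ne_zero.2 (hG.cosine_sub_ne_zero he hθ (by omega))
  · rw [hG.localProj_mul_distKernel_mul_localProj x (by omega), ← smul_mul_assoc,
      ← Complex.ofReal_sub, hG.cosine_zero_sub_four he hθ hD]
    congr 1
    push_cast
    module

open scoped ComplexOrder in
theorem trace_tautMat_eq_zero_iff (hD : 4 ≤ G.diam) {θ θ' : ℝ} (hθ : IsExtremalEigenvalue G θ)
    (hθ' : IsExtremalEigenvalue G θ') :
    (tautMat G x (G.tildeVal θ) (G.tildeVal θ')).trace = 0 ↔
      tautMat G x (G.tildeVal θ) (G.tildeVal θ') = 0 := by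
  obtain ⟨e, -, hpos, κ, hκ, hPKP⟩ := hG.exists_posSemidef_eq_smul_mul_localProj x hD hθ
  obtain ⟨e', -, hpos', κ', hκ', hPKP'⟩ := hG.exists_posSemidef_eq_smul_mul_localProj x hD hθ'
  have hM := hpos.conjTranspose_mul_mul_same (localProj G x)
  have hN := hpos'.conjTranspose_mul_mul_same (localProj G x)
  rw [localProj_conjTranspose, hPKP] at hM
  rw [localProj_conjTranspose, hPKP'] at hN
  have hcomm : localProj G x * (localMat G x - (G.tildeVal θ' : ℂ) • 1) =
      (localMat G x - (G.tildeVal θ' : ℂ) • 1) * localProj G x := by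
    rw [mul_sub, sub_mul, hG.localProj_mul_localMat x (by omega), mul_smul_comm, smul_mul_assoc,
      mul_one, one_mul]
  have hprod : κ • ((localMat G x - (G.tildeVal θ : ℂ) • 1) * localProj G x) *
      κ' • ((localMat G x - (G.tildeVal θ' : ℂ) • 1) * localProj G x) =
        (κ * κ') • tautMat G x (G.tildeVal θ) (G.tildeVal θ') := by
    rw [smul_mul_assoc, mul_smul_comm, smul_smul, tautMat, mul_assoc,
      ← mul_assoc (localProj G x), hcomm, mul_assoc _ (localProj G x),
      hG.localProj_mul_self x (by omega)]
  refine ⟨fun h => ?_, fun h => by rw [h, Matrix.trace_zero]⟩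
  have hzero := mul_eq_zero_of_trace_mul_eq_zero hM hN <| by
    rw [hprod, Matrix.trace_smul, h, smul_zero]
  exact (smul_eq_zero.1 (hprod ▸ hzero)).resolve_left (mul_ne_zero hκ hκ')

end TautMat

end IsBipartiteDRG

/-- The last factor on the left is the trace of `tautMat`, the last factor on the right is the
difference of the two sides of the taut condition. Here `k` is the valency, `b = b_2`, `c = b_3`,
`u = θ_1²`, `w = θ_d²` and `p = p^2_{22}`. -/
theorem taut_condition_identity {K : Type*} [Field K] {k b c u w p : K} (hu : u - b ≠ 0)
    (hw : w - b ≠ 0) (hb : k - b ≠ 0)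
    (hp : p = ((k - 1 - (k - c)) * (k - b) + (k - c - 1) * k) / (k - b)) :
    (u - b) * (w - b) * (k - b) * (b - 1) *
      (k * (k - 1) / (k - b) * p - p ^ 2 - (k - 1) * (c - 1) ^ 2 -
        (-1 - b * c / (u - b) + (-1 - b * c / (w - b))) * -(p + (k - 1) * (c - 1)) +
        (-1 - b * c / (u - b)) * (-1 - b * c / (w - b)) * (k * (k - 1) / (k - b) - k)) =
    k * c * (c * (b * (k - 2) - (k - b - 1) * u) * (b * (k - 2) - (k - b - 1) * w) -
      (k - 1) * ((k - 2) * (k - c - 1) - (k - b - 1) * p) * (u - b) * (b - w)) := by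
  rw [hp]
  field_simp
  ring

namespace IsBipartiteDRG

variable {V : Type*} [Fintype V] [DecidableEq V] {G : SimpleGraph V} (hG : IsBipartiteDRG G)
include hG

theorem mul_trace_tautMat_tildeVal (hD : 3 ≤ G.diam) {θ θ' : ℝ} (hθ : θ ^ 2 - G.drgB 2 ≠ 0)
    (hθ' : θ' ^ 2 - G.drgB 2 ≠ 0) (x : V) :
    (((θ ^ 2 - G.drgB 2) * (θ' ^ 2 - G.drgB 2) * G.drgC 2 * (G.drgB 2 - 1) : ℝ) : ℂ) *
        (tautMat G x (G.tildeVal θ) (G.tildeVal θ')).trace =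
      (G.valency * G.drgB 3 *
        (G.drgB 3 * (G.drgB 2 * (G.valency - 2) - (G.drgC 2 - 1) * θ ^ 2) *
            (G.drgB 2 * (G.valency - 2) - (G.drgC 2 - 1) * θ' ^ 2) -
          G.drgB 1 * G.tautDelta * (θ ^ 2 - G.drgB 2) * (G.drgB 2 - θ' ^ 2)) : ℝ) := by
  have hc2 := hG.cast_drgC_ne_zero (i := 2) (by omega) (by omega)
  have h1 := eq_sub_of_add_eq (hG.cast_valency_eq (by omega)).symm
  have h2 : (G.drgC 2 : ℂ) = G.valency - G.drgB 2 := by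
    rw [hG.cast_drgB_eq (by omega), sub_sub_cancel]
  have h3 : (G.drgC 3 : ℂ) = G.valency - G.drgB 3 := by
    rw [hG.cast_drgB_eq (by omega), sub_sub_cancel]
  have hk2 := eq_div_of_mul_eq hc2 ((mul_comm _ _).trans hG.drgC_two_mul_interNum_zero)
  have hp := eq_div_of_mul_eq hc2 ((mul_comm _ _).trans (hG.drgC_two_mul_interNum_two (by omega)))
  rw [h2] at hc2
  rw [h1, h2, h3] at hp
  rw [h1, h2] at hk2
  rw [trace_tautMat, hG.trace_localMat_mul_localMat_mul_localProj x hD,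
    hG.trace_localMat_mul_localProj x hD, hG.trace_localProj x hD]
  simp only [SimpleGraph.tildeVal, SimpleGraph.tautDelta]
  push_cast
  rw [h1, h2, h3, hk2]
  exact taut_condition_identity (by exact_mod_cast hθ) (by exact_mod_cast hθ') hc2 hp

theorem isTaut_iff [DecidableRel G.Adj] (hD : 4 ≤ G.diam) (hodd : Odd G.diam)
    (hk : 3 ≤ G.valency) (x : V) :
    G.IsTaut ↔ G.tautDelta ≠ 0 ∧
      tautMat G x (G.tildeVal (G.theta 1)) (G.tildeVal (G.theta (G.diam / 2))) = 0 := by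
  have hθ₁ := hG.isExtremalEigenvalue_theta_one hodd (by omega)
  have hθ_d := hG.isExtremalEigenvalue_theta_half hodd (by omega)
  have hu := hG.sq_ne_drgB_two hθ₁ hD
  have hw := hG.sq_ne_drgB_two hθ_d hD
  have hk0 : (G.valency : ℝ) ≠ 0 := Nat.cast_ne_zero.2 (by omega)
  have hb3 : (G.drgB 3 : ℝ) ≠ 0 := Nat.cast_ne_zero.2 (drgB_pos hG.drg (by omega)).ne'
  have hb2 : (G.drgB 2 : ℝ) - 1 ≠ 0 :=
    sub_ne_zero.2 (Nat.cast_ne_one.2 (hG.drgB_two_ne_one hD hk))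
  have hc2 : (G.drgC 2 : ℝ) ≠ 0 :=
    Nat.cast_ne_zero.2 (drgC_pos hG.drg (by omega) (by omega)).ne'
  have htrace := hG.mul_trace_tautMat_tildeVal (by omega) hu hw x
  rw [SimpleGraph.IsTaut, ← hG.trace_tautMat_eq_zero_iff x hD hθ₁ hθ_d,
    ← mul_eq_zero_iff_left (Complex.ofReal_ne_zero.2
      (mul_ne_zero (mul_ne_zero (mul_ne_zero hu hw) hc2) hb2)), htrace, Complex.ofReal_eq_zero,
    mul_eq_zero_iff_left (mul_ne_zero hk0 hb3), sub_eq_zero]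

end IsBipartiteDRG

section TModule

variable {V : Type*} [Fintype V] [DecidableEq V] {G : SimpleGraph V} {x : V}

theorem dualIdem_mulVec_apply (i : ℕ) (w : V → ℂ) (y : V) :
    (G.dualIdem x i *ᵥ w) y = if G.dist x y = i then w y else 0 := by
  simp [SimpleGraph.dualIdem, Matrix.mulVec_diagonal]

theorem dualIdem_mulVec_eq_iff {i : ℕ} {u w : V → ℂ} :
    G.dualIdem x i *ᵥ u = G.dualIdem x i *ᵥ w ↔ ∀ y, G.dist x y = i → u y = w y := by
  simp only [funext_iff, dualIdem_mulVec_apply]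
  exact forall_congr' fun y => by split_ifs <;> simp_all

theorem sum_dualIdem_mulVec {w : V → ℂ} {n : ℕ} (hw : ∀ y, n ≤ G.dist x y → w y = 0) :
    ∑ i ∈ Finset.range n, G.dualIdem x i *ᵥ w = w := by
  ext y
  simp only [Finset.sum_apply, dualIdem_mulVec_apply, Finset.sum_ite_eq, Finset.mem_range]
  exact ite_eq_left_iff.2 fun hy => (hw y (not_lt.1 hy)).symm

theorem mem_dualPart {i : ℕ} {W : Submodule ℂ (V → ℂ)} {v : V → ℂ} :
    v ∈ G.dualPart x i W ↔ ∃ w ∈ W, G.dualIdem x i *ᵥ w = v :=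
  Submodule.mem_map

theorem dualPart_eq_bot_iff {i : ℕ} {W : Submodule ℂ (V → ℂ)} :
    G.dualPart x i W = ⊥ ↔ ∀ w ∈ W, G.dualIdem x i *ᵥ w = 0 := by
  rw [SimpleGraph.dualPart, ← LinearMap.le_ker_iff_map]
  rfl

variable [DecidableRel G.Adj]

theorem isTModule_of_adjMatrix_of_dualIdem {W : Submodule ℂ (V → ℂ)}
    (hA : ∀ w ∈ W, G.adjMatrix ℂ *ᵥ w ∈ W)
    (hE : ∀ i ≤ G.diam, ∀ w ∈ W, G.dualIdem x i *ᵥ w ∈ W) : G.IsTModule x W := by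
  intro B hB
  induction hB using Algebra.adjoin_induction with
  | mem B hB =>
    obtain rfl | ⟨i, hi, rfl⟩ := hB
    · exact hA
    · exact hE i hi
  | algebraMap a =>
    intro w hw
    rw [Algebra.algebraMap_eq_smul_one, Matrix.smul_mulVec, Matrix.one_mulVec]
    exact W.smul_mem a hw
  | add B C _ _ hB hC =>
    intro w hw
    rw [Matrix.add_mulVec]
    exact W.add_mem (hB w hw) (hC w hw)
  | mul B C _ _ hB hC =>
    intro w hw
    rw [← Matrix.mulVec_mulVec]
    exact hB _ (hC w hw)

theorem adjMatrix_mem_subconstAlg : G.adjMatrix ℂ ∈ G.subconstAlg x :=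
  Algebra.subset_adjoin (Or.inl rfl)

theorem dualIdem_mem_subconstAlg_of_le {i : ℕ} (hi : i ≤ G.diam) :
    G.dualIdem x i ∈ G.subconstAlg x :=
  Algebra.subset_adjoin (Or.inr ⟨i, hi, rfl⟩)

theorem exists_isIrredTModule_le {K : Submodule ℂ (V → ℂ)} (hK : G.IsTModule x K)
    (hne : K ≠ ⊥) : ∃ W ≤ K, G.IsIrredTModule x W := by
  obtain ⟨W, ⟨hT, hW, hWK⟩, hmin⟩ := wellFounded_lt.has_min
    {W : Submodule ℂ (V → ℂ) | G.IsTModule x W ∧ W ≠ ⊥ ∧ W ≤ K} ⟨K, hK, hne, le_rfl⟩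
  refine ⟨W, hWK, hT, hW, fun W' hT' hle => or_iff_not_imp_left.2 fun hW' => ?_⟩
  exact eq_of_le_of_not_lt hle (hmin W' ⟨hT', hW', hle.trans hWK⟩)

open scoped ComplexOrder in
/-- The vectors orthogonal to all irreducible `T(x)`-modules form a `T(x)`-module, because the
generators of `T(x)` are Hermitian. It contains no irreducible module, hence it is zero; but it
contains the range of `Mᴴ`. -/
theorem eq_zero_of_forall_isIrredTModule_mulVec_eq_zero {M : Matrix V V ℂ}
    (hM : ∀ W, G.IsIrredTModule x W → ∀ w ∈ W, M *ᵥ w = 0) : M = 0 := by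
  have hadjoint (N : Matrix V V ℂ) (u v : V → ℂ) : star u ⬝ᵥ Nᴴ *ᵥ v = star (N *ᵥ u) ⬝ᵥ v := by
    rw [Matrix.star_mulVec, Matrix.dotProduct_mulVec]
  let K : Submodule ℂ (V → ℂ) :=
    { carrier := {v | ∀ W, G.IsIrredTModule x W → ∀ w ∈ W, star w ⬝ᵥ v = 0}
      add_mem' := fun hu hv W hW w hw => by
        rw [dotProduct_add, hu W hW w hw, hv W hW w hw, add_zero]
      zero_mem' := fun _ _ _ _ => dotProduct_zero _
      smul_mem' := fun c v hv W hW w hw => by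
        rw [dotProduct_smul, hv W hW w hw, smul_zero] }
  have hK_mulVec {N : Matrix V V ℂ} (hN : Nᴴ = N) (hNT : N ∈ G.subconstAlg x) :
      ∀ v ∈ K, N *ᵥ v ∈ K := fun v hv W hW w hw => by
    rw [← hN, hadjoint]
    exact hv W hW _ (hW.1 N hNT w hw)
  have hK : G.IsTModule x K := isTModule_of_adjMatrix_of_dualIdem
    (hK_mulVec isHermitian_adjMatrix.eq adjMatrix_mem_subconstAlg)
    fun i hi => hK_mulVec (dualIdem_conjTranspose x i) (dualIdem_mem_subconstAlg_of_le hi)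
  have hK_bot : K = ⊥ := by
    by_contra hne
    obtain ⟨W, hWK, hW⟩ := exists_isIrredTModule_le hK hne
    obtain ⟨w, hw, hw0⟩ := Submodule.exists_mem_ne_zero_of_ne_bot hW.2.1
    exact hw0 (dotProduct_star_self_eq_zero.1 (hWK hw W hW w hw))
  rw [← Matrix.conjTranspose_eq_zero]
  refine Matrix.ext_of_mulVec_single fun y => ?_
  have hmem : Mᴴ *ᵥ Pi.single y 1 ∈ K := fun W hW w hw => by
    rw [hadjoint, hM W hW w hw, star_zero, zero_dotProduct]
  rwa [hK_bot, Submodule.mem_bot, ← Matrix.zero_mulVec (Pi.single y 1)] at hmem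

end TModule

section CyclicSpan

variable {V : Type*} [Fintype V] (G : SimpleGraph V)

/-- The image of `v` under the matrices `distKernel G e`; for a distance-regular graph this is the
image of `v` under the Bose-Mesner algebra. -/
noncomputable def cyclicSpan (v : V → ℂ) : Submodule ℂ (V → ℂ) :=
  LinearMap.range ((Matrix.mulVecBilin ℂ ℂ).flip v ∘ₗ distKernel G)

variable {G}

theorem mem_cyclicSpan {v w : V → ℂ} : w ∈ cyclicSpan G v ↔ ∃ e, distKernel G e *ᵥ v = w :=
  LinearMap.mem_range

theorem distKernel_mulVec_mem_cyclicSpan (e : ℕ → ℂ) (v : V → ℂ) :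
    distKernel G e *ᵥ v ∈ cyclicSpan G v :=
  mem_cyclicSpan.2 ⟨e, rfl⟩

theorem self_mem_cyclicSpan (hG : G.Connected) (v : V → ℂ) : v ∈ cyclicSpan G v := by
  classical
  refine mem_cyclicSpan.2 ⟨Pi.single 0 1, ?_⟩
  rw [distKernel_single_zero hG, map_one, Matrix.one_mulVec]

variable (G) [DecidableEq V] in
/-- A vector `v` such that `cyclicSpan G v` meets the spheres around `x` in the subspaces spanned
by the vectors `E_{r+j}^* A_j v`. Such a vector generates a thin `T(x)`-module of endpoint `r`. -/
structure IsThinGenerator (x : V) (r : ℕ) (v : V → ℂ) : Prop where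
  dualIdem_mulVec : G.dualIdem x r *ᵥ v = v
  dualIdem_mulVec_of_lt : ∀ i < r, ∀ e, G.dualIdem x i *ᵥ (distKernel G e *ᵥ v) = 0
  exists_eq_smul : ∀ j e, ∃ c : ℂ, G.dualIdem x (r + j) *ᵥ (distKernel G e *ᵥ v) =
    c • (G.dualIdem x (r + j) *ᵥ (distKernel G (Pi.single j 1) *ᵥ v))

end CyclicSpan

namespace IsBipartiteDRG

section TModule

variable {V : Type*} [Fintype V] [DecidableEq V] {G : SimpleGraph V} (hG : IsBipartiteDRG G)
  {x : V}
include hG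

theorem dualIdem_eq_zero {i : ℕ} (hi : G.diam < i) : G.dualIdem x i = 0 := by
  rw [SimpleGraph.dualIdem, Matrix.diagonal_eq_zero]
  exact funext fun y => if_neg ((hG.dist_le x y).trans_lt hi).ne

theorem dualIdem_mulVec_eq_zero_of_lt_endpoint {W : Submodule ℂ (V → ℂ)} {i : ℕ}
    (hi : i < G.endpoint x W) {w : V → ℂ} (hw : w ∈ W) : G.dualIdem x i *ᵥ w = 0 := by
  rcases le_or_gt i G.diam with hd | hd
  · exact dualPart_eq_bot_iff.1 (not_not.1 fun hne => Nat.notMem_of_lt_sInf hi ⟨hd, hne⟩) w hw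
  · rw [hG.dualIdem_eq_zero hd, Matrix.zero_mulVec]

variable [DecidableRel G.Adj]

theorem dualIdem_mem_subconstAlg (i : ℕ) : G.dualIdem x i ∈ G.subconstAlg x := by
  rcases le_or_gt i G.diam with hd | hd
  · exact dualIdem_mem_subconstAlg_of_le hd
  · rw [hG.dualIdem_eq_zero hd]
    exact zero_mem _

theorem distKernel_single_mem_subconstAlg (i : ℕ) :
    distKernel G (Pi.single i 1) ∈ G.subconstAlg x := by
  induction i using Nat.twoStepInduction with
  | zero =>
    rw [distKernel_single_zero hG.conn, map_one]
    exact one_mem _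
  | one =>
    rw [distKernel_single_one]
    exact adjMatrix_mem_subconstAlg
  | more i ih₀ ih₁ =>
    rcases le_or_gt (i + 2) G.diam with hd | hd
    · have hc := hG.cast_drgC_ne_zero (i := i + 2) (by omega) hd
      have hA := hG.adjMatrix_mul_distKernel_single (R := ℂ) i
      rw [← inv_smul_smul₀ hc (distKernel G _), eq_sub_of_add_eq' hA.symm]
      exact Subalgebra.smul_mem _ (sub_mem (mul_mem adjMatrix_mem_subconstAlg ih₁)
        (Subalgebra.smul_mem _ ih₀ _)) _
    · rw [hG.distKernel_single_eq_zero hd]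
      exact zero_mem _

theorem distKernel_mem_subconstAlg (e : ℕ → ℂ) : distKernel G e ∈ G.subconstAlg x := by
  have he : distKernel G e =
      ∑ i ∈ Finset.range (G.diam + 1), e i • distKernel G (Pi.single i 1) := by
    simp_rw [← map_smul, ← map_sum]
    refine hG.distKernel_congr fun i hi => ?_
    simp [Finset.sum_apply, Pi.single_apply, Nat.lt_succ_of_le hi]
  rw [he]
  exact sum_mem fun i _ => Subalgebra.smul_mem _ (hG.distKernel_single_mem_subconstAlg i) _

theorem sphereBlock_mem_subconstAlg (i j : ℕ) (e : ℕ → ℂ) :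
    sphereBlock G x i j e ∈ G.subconstAlg x := by
  rw [← dualIdem_mul_distKernel_mul_dualIdem]
  exact mul_mem (mul_mem (hG.dualIdem_mem_subconstAlg i) (hG.distKernel_mem_subconstAlg e))
    (hG.dualIdem_mem_subconstAlg j)

theorem exists_dualIdem_endpoint_mulVec_eq {W : Submodule ℂ (V → ℂ)}
    (hW : G.IsIrredTModule x W) :
    ∃ v ∈ W, v ≠ 0 ∧ G.dualIdem x (G.endpoint x W) *ᵥ v = v := by
  have hne : {i : ℕ | i ≤ G.diam ∧ G.dualPart x i W ≠ ⊥}.Nonempty := by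
    by_contra! hempty
    obtain ⟨w, hw, hw0⟩ := Submodule.exists_mem_ne_zero_of_ne_bot hW.2.1
    refine hw0 ?_
    rw [← sum_dualIdem_mulVec (G := G) (x := x) (w := w) (n := G.diam + 1) fun y hy =>
      absurd (hG.dist_le x y) (by omega)]
    refine Finset.sum_eq_zero fun i hi => dualPart_eq_bot_iff.1 (not_not.1 fun hi0 => ?_) w hw
    exact hempty.subset ⟨Nat.lt_succ_iff.1 (Finset.mem_range.1 hi), hi0⟩
  obtain ⟨v, hv, hv0⟩ := Submodule.exists_mem_ne_zero_of_ne_bot (Nat.sInf_mem hne).2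
  obtain ⟨w, hw, rfl⟩ := mem_dualPart.1 hv
  exact ⟨_, hW.1 _ (hG.dualIdem_mem_subconstAlg _) w hw, hv0, by
    rw [Matrix.mulVec_mulVec, SimpleGraph.endpoint, dualIdem_mul_self]⟩

theorem cyclicSpan_eq_of_isTModule {W : Submodule ℂ (V → ℂ)} (hW : G.IsIrredTModule x W)
    {v : V → ℂ} (hv : v ∈ W) (hv0 : v ≠ 0) (hT : G.IsTModule x (cyclicSpan G v)) :
    cyclicSpan G v = W := by
  refine (hW.2.2 _ hT fun w hw => ?_).resolve_left fun hbot => hv0 ?_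
  · obtain ⟨e, rfl⟩ := mem_cyclicSpan.1 hw
    exact hW.1 _ (hG.distKernel_mem_subconstAlg e) v hv
  · rw [← Submodule.mem_bot ℂ, ← hbot]
    exact self_mem_cyclicSpan hG.conn v

end TModule

end IsBipartiteDRG

namespace IsThinGenerator

variable {V : Type*} [Fintype V] [DecidableEq V] {G : SimpleGraph V} {x : V} {r : ℕ} {v : V → ℂ}
  (hv : IsThinGenerator G x r v)
include hv

theorem eq_zero_of_dist_ne {y : V} (hy : G.dist x y ≠ r) : v y = 0 := by
  rw [← hv.dualIdem_mulVec, dualIdem_mulVec_apply, if_neg hy]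

theorem distKernel_single_mulVec_apply_of_lt (hG : G.Connected) {j : ℕ} {y : V}
    (hy : r + j < G.dist x y) : (distKernel G (Pi.single j 1) *ᵥ v) y = 0 := by
  refine Finset.sum_eq_zero fun z _ => ?_
  have htri := hG.dist_triangle (u := x) (v := z) (w := y)
  rw [G.dist_comm (u := z)] at htri
  by_cases hz : G.dist x z = r
  · simp [distKernel_apply, show G.dist y z ≠ j by omega]
  · simp [hv.eq_zero_of_dist_ne hz]

theorem dualIdem_mulVec_single_mem_cyclicSpan (hG : G.Connected) (j : ℕ) :
    G.dualIdem x (r + j) *ᵥ (distKernel G (Pi.single j 1) *ᵥ v) ∈ cyclicSpan G v := by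
  induction j using Nat.strong_induction_on with
  | _ j ih =>
    have hsum := sum_dualIdem_mulVec (x := x) (w := distKernel G (Pi.single j 1) *ᵥ v)
      (n := r + j + 1) fun y hy => hv.distKernel_single_mulVec_apply_of_lt hG hy
    rw [Finset.sum_range_succ] at hsum
    rw [eq_sub_of_add_eq' hsum]
    refine sub_mem (distKernel_mulVec_mem_cyclicSpan _ v) (sum_mem fun i hi => ?_)
    rcases lt_or_ge i r with hir | hir
    · rw [hv.dualIdem_mulVec_of_lt i hir]
      exact zero_mem _
    · obtain ⟨l, rfl⟩ := Nat.exists_eq_add_of_le hir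
      obtain ⟨c, hc⟩ := hv.exists_eq_smul l (Pi.single j 1)
      rw [hc]
      exact Submodule.smul_mem _ c (ih l (by simpa using hi))

theorem dualPart_cyclicSpan_add_le (j : ℕ) : G.dualPart x (r + j) (cyclicSpan G v) ≤
    ℂ ∙ (G.dualIdem x (r + j) *ᵥ (distKernel G (Pi.single j 1) *ᵥ v)) := by
  intro w hw
  obtain ⟨_, hu, rfl⟩ := mem_dualPart.1 hw
  obtain ⟨e, rfl⟩ := mem_cyclicSpan.1 hu
  obtain ⟨c, hc⟩ := hv.exists_eq_smul j e
  exact Submodule.mem_span_singleton.2 ⟨c, hc.symm⟩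

theorem dualPart_cyclicSpan_eq_bot {i : ℕ} (hi : i < r) :
    G.dualPart x i (cyclicSpan G v) = ⊥ :=
  dualPart_eq_bot_iff.2 fun w hw => by
    obtain ⟨e, rfl⟩ := mem_cyclicSpan.1 hw
    exact hv.dualIdem_mulVec_of_lt i hi e

theorem isThin_cyclicSpan : G.IsThin x (cyclicSpan G v) := by
  intro i _
  rcases lt_or_ge i r with hi | hi
  · rw [hv.dualPart_cyclicSpan_eq_bot hi, finrank_bot]
    exact zero_le_one
  · obtain ⟨j, rfl⟩ := Nat.exists_eq_add_of_le hi
    exact (Submodule.finrank_mono (hv.dualPart_cyclicSpan_add_le j)).trans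
      ((finrank_span_le_card _).trans (by simp))

theorem isTModule_cyclicSpan [DecidableRel G.Adj] (hG : IsBipartiteDRG G) :
    G.IsTModule x (cyclicSpan G v) := by
  refine isTModule_of_adjMatrix_of_dualIdem (fun w hw => ?_) fun i _ w hw => ?_
  · obtain ⟨e, rfl⟩ := mem_cyclicSpan.1 hw
    rw [Matrix.mulVec_mulVec, hG.adjMatrix_mul_distKernel]
    exact distKernel_mulVec_mem_cyclicSpan _ v
  · have hwi : G.dualIdem x i *ᵥ w ∈ G.dualPart x i (cyclicSpan G v) := mem_dualPart.2 ⟨w, hw, rfl⟩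
    rcases lt_or_ge i r with hi | hi
    · rw [(Submodule.eq_bot_iff _).1 (hv.dualPart_cyclicSpan_eq_bot hi) _ hwi]
      exact zero_mem _
    · obtain ⟨j, rfl⟩ := Nat.exists_eq_add_of_le hi
      exact (Submodule.span_singleton_le_iff_mem _ _).2
        (hv.dualIdem_mulVec_single_mem_cyclicSpan hG.conn j) (hv.dualPart_cyclicSpan_add_le j hwi)

theorem cyclicSpan_eq [DecidableRel G.Adj] (hG : IsBipartiteDRG G) {W : Submodule ℂ (V → ℂ)}
    (hW : G.IsIrredTModule x W) (hvW : v ∈ W) (hv0 : v ≠ 0) : cyclicSpan G v = W :=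
  hG.cyclicSpan_eq_of_isTModule hW hvW hv0 (hv.isTModule_cyclicSpan hG)

end IsThinGenerator

section ThinGenerator

variable {V : Type*} [Fintype V] [DecidableEq V] {G : SimpleGraph V} {x : V} {v : V → ℂ}

theorem distKernel_one_mulVec_eq_zero
    (hv : G.dualIdem x 0 *ᵥ (distKernel G 1 *ᵥ v) = 0) : distKernel G 1 *ᵥ v = 0 := by
  have hx := congrFun hv x
  rw [dualIdem_mulVec_apply, if_pos G.dist_self] at hx
  exact funext fun _ => hx

namespace IsBipartiteDRG

variable (hG : IsBipartiteDRG G)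
include hG

theorem distKernel_mulVec_apply_of_dist_eq {r j : ℕ} (hv : G.dualIdem x r *ᵥ v = v) {y : V}
    (hy : G.dist x y = r + j) (e : ℕ → ℂ) : (distKernel G e *ᵥ v) y =
      ∑ t ∈ Finset.range (r + 1),
        e (j + 2 * t) * (distKernel G (Pi.single (j + 2 * t) 1) *ᵥ v) y := by
  simp only [Matrix.mulVec, dotProduct, distKernel_apply, Finset.mul_sum]
  rw [Finset.sum_comm]
  refine Finset.sum_congr rfl fun z _ => ?_
  rw [← hv, dualIdem_mulVec_apply]
  split_ifs with hz
  · obtain ⟨t, ht, hyz⟩ : ∃ t < r + 1, G.dist y z = j + 2 * t := by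
      have heven := hG.even_dist x y z
      have htri₁ := hG.dist_tri x z y
      have htri₂ := hG.dist_tri y x z
      rw [G.dist_comm (u := z)] at htri₁
      rw [G.dist_comm (u := y) (v := x)] at htri₂
      refine ⟨(G.dist y z - j) / 2, ?_, ?_⟩ <;> omega
    rw [Finset.sum_eq_single_of_mem t (Finset.mem_range.2 ht), hyz, Pi.single_eq_same, one_mul]
    intro s _ hst
    rw [hyz, Pi.single_eq_of_ne (by omega), zero_mul, mul_zero]
  · simp

theorem isThinGenerator_zero (hv : G.dualIdem x 0 *ᵥ v = v) : IsThinGenerator G x 0 v where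
  dualIdem_mulVec := hv
  dualIdem_mulVec_of_lt i hi := absurd hi i.not_lt_zero
  exists_eq_smul j e := by
    refine ⟨e j, ?_⟩
    rw [← Matrix.mulVec_smul, dualIdem_mulVec_eq_iff]
    intro y hy
    rw [hG.distKernel_mulVec_apply_of_dist_eq hv hy]
    simp

theorem isThinGenerator_one (hv : G.dualIdem x 1 *ᵥ v = v)
    (hlow : ∀ i < 1, ∀ e, G.dualIdem x i *ᵥ (distKernel G e *ᵥ v) = 0) :
    IsThinGenerator G x 1 v where
  dualIdem_mulVec := hv
  dualIdem_mulVec_of_lt := hlow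
  exists_eq_smul j e := by
    refine ⟨e j - e (j + 2), ?_⟩
    rw [← Matrix.mulVec_smul, dualIdem_mulVec_eq_iff]
    intro y hy
    have hone := hG.distKernel_mulVec_apply_of_dist_eq hv hy 1
    rw [distKernel_one_mulVec_eq_zero (hlow 0 one_pos 1)] at hone
    rw [hG.distKernel_mulVec_apply_of_dist_eq hv hy e]
    simp only [Finset.sum_range_succ, Finset.sum_range_zero, zero_add, mul_zero, add_zero,
      mul_one, Pi.zero_apply, Pi.one_apply, one_mul, Pi.smul_apply, smul_eq_mul] at hone ⊢
    linear_combination -e (j + 2) * hone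

/-- On the sphere of radius `j + 2`, the equations `J v = 0` and `K v = 0`, for `J` the all-ones
matrix and `K = distKernel G e`, express `A_{j+2} v` and `A_{j+4} v` through `A_j v`. -/
theorem isThinGenerator_two (hv : G.dualIdem x 2 *ᵥ v = v)
    (hlow : ∀ i < 2, ∀ e, G.dualIdem x i *ᵥ (distKernel G e *ᵥ v) = 0) {e : ℕ → ℂ}
    (he : ∀ i, i + 2 ≤ G.diam → e i ≠ e (i + 2)) (hev : distKernel G e *ᵥ v = 0) :
    IsThinGenerator G x 2 v where
  dualIdem_mulVec := hv
  dualIdem_mulVec_of_lt := hlow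
  exists_eq_smul j f := by
    have hexpand (f : ℕ → ℂ) {y : V} (hy : G.dist x y = 2 + j) : (distKernel G f *ᵥ v) y =
        f j * (distKernel G (Pi.single j 1) *ᵥ v) y +
          f (j + 2) * (distKernel G (Pi.single (j + 2) 1) *ᵥ v) y +
          f (j + 4) * (distKernel G (Pi.single (j + 4) 1) *ᵥ v) y := by
      rw [hG.distKernel_mulVec_apply_of_dist_eq hv hy]
      simp [Finset.sum_range_succ]
    have hone {y : V} (hy : G.dist x y = 2 + j) := hexpand 1 hy
    have hzero {y : V} (hy : G.dist x y = 2 + j) := hexpand e hy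
    simp only [distKernel_one_mulVec_eq_zero (hlow 0 two_pos 1), hev, Pi.zero_apply, Pi.one_apply,
      one_mul] at hone hzero
    obtain ⟨m, hm⟩ : ∃ m : ℂ, ∀ y, G.dist x y = 2 + j →
        (distKernel G (Pi.single (j + 4) 1) *ᵥ v) y =
          m * (distKernel G (Pi.single j 1) *ᵥ v) y := by
      rcases le_or_gt (j + 4) G.diam with hd | hd
      · refine ⟨(e j - e (j + 2)) / (e (j + 2) - e (j + 4)), fun y hy => ?_⟩
        have hne : e (j + 2) - e (j + 4) ≠ 0 := sub_ne_zero.2 (he (j + 2) hd)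
        rw [div_mul_eq_mul_div, eq_div_iff hne]
        linear_combination hzero hy - e (j + 2) * hone hy
      · refine ⟨0, fun y _ => ?_⟩
        rw [hG.distKernel_single_eq_zero hd, Matrix.zero_mulVec, zero_mul, Pi.zero_apply]
    refine ⟨f j - f (j + 2) * (1 + m) + f (j + 4) * m, ?_⟩
    rw [← Matrix.mulVec_smul, dualIdem_mulVec_eq_iff]
    intro y hy
    rw [hexpand f hy, Pi.smul_apply, smul_eq_mul]
    linear_combination (f (j + 4) - f (j + 2)) * hm y hy - f (j + 2) * hone hy

end IsBipartiteDRG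

end ThinGenerator

section LocalModule

variable {V : Type*} [Fintype V] [DecidableEq V] {G : SimpleGraph V} {x : V} {v : V → ℂ}

theorem localProj_mulVec_eq_self (hv : G.dualIdem x 2 *ᵥ v = v)
    (hlow : ∀ i < 2, ∀ e, G.dualIdem x i *ᵥ (distKernel G e *ᵥ v) = 0) :
    localProj G x *ᵥ v = v := by
  have hN : (sphereIncidence G x)ᴴ *ᵥ v = 0 := by
    rw [sphereIncidence_conjTranspose, ← dualIdem_mul_distKernel_mul_dualIdem,
      ← Matrix.mulVec_mulVec, hv, ← Matrix.mulVec_mulVec, hlow 1 one_lt_two]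
  have hJ : sphereBlock G x 2 2 1 *ᵥ v = 0 := by
    rw [← dualIdem_mul_distKernel_mul_dualIdem, ← Matrix.mulVec_mulVec, hv, ← Matrix.mulVec_mulVec,
      distKernel_one_mulVec_eq_zero (hlow 0 two_pos 1), Matrix.mulVec_zero]
  rw [localProj, Matrix.add_mulVec, Matrix.sub_mulVec, Matrix.smul_mulVec, Matrix.smul_mulVec, hJ,
    ← Matrix.mulVec_mulVec, hN, hv, Matrix.mulVec_zero, smul_zero, smul_zero, sub_zero, add_zero]

theorem localMat_sub_smul_one_mulVec_eq_zero_iff {η : ℂ} :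
    (localMat G x - η • 1) *ᵥ v = 0 ↔ localMat G x *ᵥ v = η • v := by
  rw [Matrix.sub_mulVec, Matrix.smul_mulVec, Matrix.one_mulVec, sub_eq_zero]

theorem tautMat_mulVec (η η' : ℝ) (w : V → ℂ) : tautMat G x η η' *ᵥ w =
    (localMat G x - (η : ℂ) • 1) *ᵥ
      ((localMat G x - (η' : ℂ) • 1) *ᵥ (localProj G x *ᵥ w)) := by
  simp only [tautMat, Matrix.mulVec_mulVec]

theorem tautMat_mulVec_eq_zero_of_localProj_mulVec {η η' : ℝ} {w : V → ℂ}
    (h : localMat G x *ᵥ (localProj G x *ᵥ w) = (η : ℂ) • (localProj G x *ᵥ w) ∨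
      localMat G x *ᵥ (localProj G x *ᵥ w) = (η' : ℂ) • (localProj G x *ᵥ w)) :
    tautMat G x η η' *ᵥ w = 0 := by
  rw [tautMat_mulVec]
  rcases h with h | h
  · rw [Matrix.sub_mulVec _ ((η' : ℂ) • 1), h, Matrix.smul_mulVec, Matrix.one_mulVec, ← sub_smul,
      Matrix.mulVec_smul, localMat_sub_smul_one_mulVec_eq_zero_iff.2 h, smul_zero]
  · rw [localMat_sub_smul_one_mulVec_eq_zero_iff.2 h, Matrix.mulVec_zero]

theorem IsThinGenerator.localProj_mulVec_eq_zero {r j : ℕ} (hv : IsThinGenerator G x r v)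
    (hrj : r + j = 2) (hP : localProj G x * sphereBlock G x 2 r (Pi.single j 1) = 0) {w : V → ℂ}
    (hw : w ∈ cyclicSpan G v) : localProj G x *ᵥ w = 0 := by
  have hspan := hv.dualPart_cyclicSpan_add_le j (mem_dualPart.2 ⟨w, hw, rfl⟩)
  obtain ⟨c, hc⟩ := Submodule.mem_span_singleton.1 hspan
  rw [hrj] at hc
  have hEK : G.dualIdem x 2 *ᵥ (distKernel G (Pi.single j 1) *ᵥ v) =
      sphereBlock G x 2 r (Pi.single j 1) *ᵥ v := by
    rw [← dualIdem_mul_distKernel_mul_dualIdem, ← Matrix.mulVec_mulVec, hv.dualIdem_mulVec,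
      Matrix.mulVec_mulVec]
  rw [← localProj_mul_dualIdem, ← Matrix.mulVec_mulVec, ← hc, hEK, Matrix.mulVec_smul,
    Matrix.mulVec_mulVec, hP, Matrix.zero_mulVec, smul_zero]

end LocalModule

namespace IsBipartiteDRG

variable {V : Type*} [Fintype V] [DecidableEq V] {G : SimpleGraph V} [DecidableRel G.Adj]
  (hG : IsBipartiteDRG G) {x : V} {W : Submodule ℂ (V → ℂ)} {v w : V → ℂ}
include hG

theorem dualIdem_mulVec_distKernel_mulVec_eq_zero (hW : G.IsTModule x W) (hv : v ∈ W) {i : ℕ}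
    (hi : i < G.endpoint x W) (e : ℕ → ℂ) : G.dualIdem x i *ᵥ (distKernel G e *ᵥ v) = 0 :=
  hG.dualIdem_mulVec_eq_zero_of_lt_endpoint hi (hW _ (hG.distKernel_mem_subconstAlg e) v hv)

open scoped ComplexOrder in
theorem exists_distKernel_mulVec_eq_zero (hD : 4 ≤ G.diam) {θ : ℝ}
    (hθ : IsExtremalEigenvalue G θ) (hP : localProj G x *ᵥ v = v)
    (hB : localMat G x *ᵥ v = (G.tildeVal θ : ℂ) • v) :
    ∃ e : ℕ → ℂ, (∀ i, i + 2 ≤ G.diam → e i ≠ e (i + 2)) ∧ distKernel G e *ᵥ v = 0 := by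
  obtain ⟨e, he, hpos, κ, -, hPKP⟩ := hG.exists_posSemidef_eq_smul_mul_localProj x hD hθ
  have hPKv : localProj G x *ᵥ (distKernel G e *ᵥ v) = 0 := by
    have h := congrArg (· *ᵥ v) hPKP
    simp only [← Matrix.mulVec_mulVec, Matrix.smul_mulVec, hP] at h
    rw [h, localMat_sub_smul_one_mulVec_eq_zero_iff.2 hB, smul_zero]
  refine ⟨e, he, (hpos.dotProduct_mulVec_zero_iff v).1 ?_⟩
  nth_rewrite 1 [← hP]
  rw [Matrix.star_mulVec, localProj_conjTranspose, ← Matrix.dotProduct_mulVec, hPKv,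
    dotProduct_zero]

theorem isThin_and_hasLocalEigenvalue (hD : 4 ≤ G.diam) {θ : ℝ} (hθ : IsExtremalEigenvalue G θ)
    (hW : G.IsIrredTModule x W) (hend : G.endpoint x W = 2) (hvW : v ∈ W) (hv0 : v ≠ 0)
    (hv : G.dualIdem x 2 *ᵥ v = v) (hB : localMat G x *ᵥ v = (G.tildeVal θ : ℂ) • v) :
    G.IsThin x W ∧ G.HasLocalEigenvalue x W (G.tildeVal θ) := by
  have hlow : ∀ i < 2, ∀ e, G.dualIdem x i *ᵥ (distKernel G e *ᵥ v) = 0 := fun i hi e =>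
    hG.dualIdem_mulVec_distKernel_mulVec_eq_zero hW.1 hvW (hend ▸ hi) e
  obtain ⟨e, he, hev⟩ :=
    hG.exists_distKernel_mulVec_eq_zero hD hθ (localProj_mulVec_eq_self hv hlow) hB
  have hgen := hG.isThinGenerator_two hv hlow he hev
  rw [← hgen.cyclicSpan_eq hG hW hvW hv0]
  refine ⟨hgen.isThin_cyclicSpan, fun u hu => ?_⟩
  obtain ⟨c, rfl⟩ := Submodule.mem_span_singleton.1 (hgen.dualPart_cyclicSpan_add_le 0 hu)
  rw [add_zero, distKernel_single_zero hG.conn, map_one, Matrix.one_mulVec, hv, ← localMat_eq,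
    Matrix.mulVec_smul, hB, smul_comm]

/-- If `v` spans no eigenspace of `B = E_2^* A_2 E_2^*` for the second eigenvalue, then
`(B - θ̃_d) v` is an eigenvector for the first one. -/
theorem isTautAt_of_tautMat_eq_zero (hD : 4 ≤ G.diam) (hodd : Odd G.diam)
    (h0 : tautMat G x (G.tildeVal (G.theta 1)) (G.tildeVal (G.theta (G.diam / 2))) = 0) :
    G.IsTautAt x := by
  intro W hW hend
  have hθ₁ := hG.isExtremalEigenvalue_theta_one hodd (by omega)
  have hθ_d := hG.isExtremalEigenvalue_theta_half hodd (by omega)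
  obtain ⟨v, hvW, hv0, hv⟩ := hG.exists_dualIdem_endpoint_mulVec_eq hW
  rw [hend] at hv
  have hP := localProj_mulVec_eq_self hv fun i hi e =>
    hG.dualIdem_mulVec_distKernel_mulVec_eq_zero hW.1 hvW (hend ▸ hi) e
  obtain ⟨u, hu⟩ : ∃ u, (localMat G x - (G.tildeVal (G.theta (G.diam / 2)) : ℂ) • 1) *ᵥ v = u :=
    ⟨_, rfl⟩
  have hBu : localMat G x *ᵥ u = (G.tildeVal (G.theta 1) : ℂ) • u := by
    rw [← localMat_sub_smul_one_mulVec_eq_zero_iff, ← hu, ← Matrix.zero_mulVec v, ← h0,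
      tautMat_mulVec, hP]
  by_cases hu0 : u = 0
  · have hBv := localMat_sub_smul_one_mulVec_eq_zero_iff.1 (hu.trans hu0)
    exact (hG.isThin_and_hasLocalEigenvalue hD hθ_d hW hend hvW hv0 hv hBv).imp_right Or.inr
  · rw [Matrix.sub_mulVec, Matrix.smul_mulVec, Matrix.one_mulVec] at hu
    have huW : u ∈ W := hu ▸ W.sub_mem
      (hW.1 _ (hG.sphereBlock_mem_subconstAlg 2 2 _) v hvW) (W.smul_mem _ hvW)
    have hEu : G.dualIdem x 2 *ᵥ u = u := by
      rw [← hu, Matrix.mulVec_sub, Matrix.mulVec_smul, hv, Matrix.mulVec_mulVec, localMat,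
        dualIdem_mul_sphereBlock]
    exact (hG.isThin_and_hasLocalEigenvalue hD hθ₁ hW hend huW hu0 hEu hBu).imp_right Or.inl

theorem localProj_mulVec_eq_zero_of_endpoint_lt_two (hD : 3 ≤ G.diam)
    (hW : G.IsIrredTModule x W) (hend : G.endpoint x W < 2) (hw : w ∈ W) :
    localProj G x *ᵥ w = 0 := by
  obtain ⟨v, hvW, hv0, hv⟩ := hG.exists_dualIdem_endpoint_mulVec_eq hW
  have hlow (i : ℕ) (hi : i < G.endpoint x W) (e : ℕ → ℂ) :=
    hG.dualIdem_mulVec_distKernel_mulVec_eq_zero hW.1 hvW hi e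
  obtain hend | hend : G.endpoint x W = 0 ∨ G.endpoint x W = 1 := by omega
  · have hgen := hG.isThinGenerator_zero (hend ▸ hv)
    refine hgen.localProj_mulVec_eq_zero (zero_add 2) ?_ (hgen.cyclicSpan_eq hG hW hvW hv0 ▸ hw)
    rw [← hG.localProj_mul_one x hD 0]
    congr 1
    refine hG.sphereBlock_congr x fun m _ _ h2m hm2 => ?_
    rw [show m = 2 by omega, Pi.single_eq_same, Pi.one_apply]
  · have hgen := hG.isThinGenerator_one (hend ▸ hv) (hend ▸ hlow)
    exact hgen.localProj_mulVec_eq_zero rfl (hG.localProj_mul_sphereIncidence x hD)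
      (hgen.cyclicSpan_eq hG hW hvW hv0 ▸ hw)

theorem tautMat_mulVec_eq_zero (hD : 3 ≤ G.diam) (hx : G.IsTautAt x)
    (hW : G.IsIrredTModule x W) (hw : w ∈ W) :
    tautMat G x (G.tildeVal (G.theta 1)) (G.tildeVal (G.theta (G.diam / 2))) *ᵥ w = 0 := by
  rcases lt_trichotomy (G.endpoint x W) 2 with hend | hend | hend
  · rw [tautMat_mulVec, hG.localProj_mulVec_eq_zero_of_endpoint_lt_two hD hW hend hw,
      Matrix.mulVec_zero, Matrix.mulVec_zero]
  · have hEw : G.dualIdem x 2 *ᵥ w ∈ W := hW.1 _ (hG.dualIdem_mem_subconstAlg 2) w hw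
    have hEEw : G.dualIdem x 2 *ᵥ (G.dualIdem x 2 *ᵥ w) = G.dualIdem x 2 *ᵥ w := by
      rw [Matrix.mulVec_mulVec, dualIdem_mul_self]
    have hPw : localProj G x *ᵥ w = G.dualIdem x 2 *ᵥ w := by
      rw [← localProj_mulVec_eq_self hEEw fun i hi e =>
          hG.dualIdem_mulVec_distKernel_mulVec_eq_zero hW.1 hEw (hend ▸ hi) e,
        Matrix.mulVec_mulVec, localProj_mul_dualIdem]
    refine tautMat_mulVec_eq_zero_of_localProj_mulVec ?_
    rw [hPw, localMat_eq]
    exact (hx W hW hend).2.imp (fun h => h _ (mem_dualPart.2 ⟨w, hw, rfl⟩))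
      fun h => h _ (mem_dualPart.2 ⟨w, hw, rfl⟩)
  · rw [tautMat_mulVec, ← localProj_mul_dualIdem, ← Matrix.mulVec_mulVec,
      hG.dualIdem_mulVec_eq_zero_of_lt_endpoint hend hw, Matrix.mulVec_zero, Matrix.mulVec_zero,
      Matrix.mulVec_zero]

theorem tautMat_eq_zero_of_isTautAt (hD : 3 ≤ G.diam) (hx : G.IsTautAt x) :
    tautMat G x (G.tildeVal (G.theta 1)) (G.tildeVal (G.theta (G.diam / 2))) = 0 :=
  eq_zero_of_forall_isIrredTModule_mulVec_eq_zero fun _ hW _ hw =>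
    hG.tautMat_mulVec_eq_zero hD hx hW hw

end IsBipartiteDRG

theorem mainTheorem3 {X : Type*} [Fintype X] [DecidableEq X]
    (G : SimpleGraph X) [DecidableRel G.Adj]
    (hG : G.IsDistanceRegular) (hbip : G.IsBipartite)
    (hD : 4 ≤ G.diam) (hodd : Odd G.diam) (hk : 3 ≤ G.valency) :
    List.TFAE [
      G.IsTaut,
      G.tautDelta ≠ 0 ∧ ∀ x : X, G.IsTautAt x,
      G.tautDelta ≠ 0 ∧ ∃ x : X, G.IsTautAt x] := by
  have h : IsBipartiteDRG G := ⟨hG, hbip⟩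
  tfae_have 1 → 2 := fun ht => ⟨ht.1, fun x =>
    h.isTautAt_of_tautMat_eq_zero hD hodd ((h.isTaut_iff hD hodd hk x).1 ht).2⟩
  tfae_have 2 → 3 := fun ⟨hΔ, ht⟩ => ⟨hΔ, h.conn.nonempty.some, ht _⟩
  tfae_have 3 → 1 := fun ⟨hΔ, x, hx⟩ =>
    (h.isTaut_iff hD hodd hk x).2 ⟨hΔ, h.tautMat_eq_zero_of_isTautAt (by omega) hx⟩
  tfae_finish
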